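/- **Setting.** Let $\Theta=\mathbb R^d$, $N\ge 1$, and let $\mathsf X,\mathsf Y,\mathsf E$ be measurable spaces with $\sigma$-finite measures $\mu$ on $\mathsf X$, $\eta$ on $\mathsf Y$ and a probability measure $\nu$ on $\mathsf E$. The data are generated by a state-space model $(X_t,Y_t)_{t\ge0}$ with transition density $\bar m(x,x')$ with respect to $\mu$, emission density $\bar g(x,y)$ with respect to $\eta$, and initial law $\chi$ of $X_0$. For $\theta\in\Theta$ let $m_\theta(x,x')$, $g_\theta(x,y)$ be the transition and emission densities of a parametric state-space model, let $q_\theta(x,x',y)$ be the density in $x'$, with respect to $\mu$, of a proposal kernel started from $(x,y)$, and let $R_\theta:\mathsf X\times\mathsf Y\times\mathsf E\to\mathsf X$ be such that $R_\theta(x,y,\cdot)$ pushes $\nu$ forward to $q_\theta(x,x',y)\mu(dx')$. All these functions are measurable in $(x,x',y,v)$ for fixed $\theta$. Put $\omega_\theta(x,x',y)=m_\theta(x,x')g_\theta(x',y)/q_\theta(x,x',y)$, and write $\nabla=\nabla_\theta$. *The chain.* For $z=(x,y,\tilde x^{1:N},v^{1:N})$ let $T_\theta(z,\cdot)$ be the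 law of $(x',y',\tilde x'^{1:N},v'^{1:N})$, where $x'\sim\bar m(x,\cdot)\mu$, $y'\sim\bar g(x',\cdot)\eta$; independently of these, $\xi^k\sim q_\theta(\tilde x^k,\cdot,y)\mu$ independently for $k\le N$ and, given $\xi^{1:N}$, $\tilde x'^j=\xi^{I_j}$ with $I_1,\dots,I_N$ independent and $\Pr(I_j=i)\propto\omega_\theta(\tilde x^i,\xi^i,y)$; and $v'^{1:N}\sim\nu^{\otimes N}$ is independent of everything else. Let $$H_\theta(z)=\nabla\log\sum_{i=1}^N\omega_\theta(\tilde x^i,R_\theta(\tilde x^i,y,v^i),y).$$ For $\theta_0\in\Theta$, a point $u\in\mathsf X$ and step sizes $(\gamma_t)_{t\ge1}$, the modified OVSMC algorithm is $\theta_{t+1}=\theta_t+\gamma_{t+1}H_{\theta_t}(Z_{t+1})$, where $Z_0\sim\chi(dx)\,\bar g(x,y)\eta(dy)\,\delta_u^{\otimes N}\,\nu^{\otimes N}$ and, given $Z_{0:t}$, $Z_{t+1}\sim T_{\theta_t}(Z_t,\cdot)$. **Assumptions.** There are $\epsilon\in(0,1)$ and $\kappa\in[1,\infty)$ such that the following hold.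 1. (Strong mixing) $\bar m$, $m_\theta$, $g_\theta$ and $q_\theta$ take values in $[\epsilon,1/\epsilon]$, for all arguments and all $\theta$. 2. (Gradients) For all $x,x',y,v$: the functions $\theta\mapsto m_\theta(x,x')$, $g_\theta(x,y)$, $q_\theta(x,x',y)$ are $\kappa$-Lipschitz; the composed functions $\theta\mapsto m_\theta(x,R_\theta(x,y,v))$, $g_\theta(R_\theta(x,y,v),y)$, $q_\theta(x,R_\theta(x,y,v),y)$ are differentiable and $\kappa$-Lipschitz, and their gradients in $\theta$ are bounded in norm by $\kappa$ and $\kappa$-Lipschitz in $\theta$. **Theorem.** Under 1 and 2, each $T_\theta$ has a unique stationary distribution $\pi_\theta$, and the mean field $h(\theta)=\int H_\theta\,d\pi_\theta$ is well defined (the integral converges). Moreover, there is $\tilde\alpha\ge1$, depending on the model only through the underlying spaces, $d$, $N$, $\epsilon$ and $\kappa$, with the following property, denoted (P): for every $\theta$ there is a measurable solution $\hat H_\theta$ of $H_\theta-h(\theta)=\hat H_\theta-T_\theta\hat H_\theta$ such that $\|H_\theta\|,\|\hat H_\theta\|,\|T_\theta\hat H_\theta\|\le\tilde\alpha$ everywhere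 and $\theta\mapsto H_\theta(z)$, $\theta\mapsto T_\theta\hat H_\theta(z)$ (for each $z$) and $\theta\mapsto h(\theta)$ are $\tilde\alpha$-Lipschitz. Suppose in addition that $h=\nabla V$ for a bounded function $V:\Theta\to\mathbb R$. Let $\gamma_t>0$, and suppose that for some $a,a'>0$ and all $t\ge1$, $$\gamma_{t+1}\le\gamma_t\le a\gamma_{t+1},\qquad \gamma_t-\gamma_{t+1}\le a'\gamma_{t+1}^2 .$$ For $t\ge0$ let $\tau$ be independent of $(Z_s)_{s\ge0}$ with the categorical distribution on $\{0,\dots,t\}$ proportional to $(\gamma_{s+1})_{s=0}^t$. (a) There are constants $b,b'>0$, possibly depending on the model, $N$ and $V$ but not on the step sizes, $a$, $a'$, $\theta_0$ or $t$, such that, whenever $\gamma_1\le c$ for some $c\in(0,1)$, for every $t\ge0$, $$\mathbb E\big[\|h(\theta_\tau)\|^2\big]\le\frac{b+b'\sum_{s=0}^t\gamma_{s+1}^2}{\sum_{s=0}^t\gamma_{s+1}} .$$ (b) For every $\tilde\alpha\ge1$ with property (P), if $\gamma_1\le 1/(2\tilde\alpha+2c_h)$ with $c_h=\tilde\alpha(a+1)/2+\tilde\alpha^2(2a+1)+\tilde\alpha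 a'$, then for every $t\ge0$, $$\mathbb E\big[\|h(\theta_\tau)\|^2\big]\le\frac{2\big(d_{0,t}+c_{0,t}+(4\tilde\alpha^3+c_\gamma)\sum_{s=0}^t\gamma_{s+1}^2\big)}{\sum_{s=0}^t\gamma_{s+1}},$$ where $d_{0,t}=\mathbb E[V(\theta_{t+1})-V(\theta_0)]$, $c_\gamma=\tilde\alpha^2(2+\tilde\alpha)$ and $c_{0,t}=\tilde\alpha(\gamma_1-\gamma_{t+1}+2)$. The expectations in (a) and (b) are of integrable random variables. -/

import Mathlib

open MeasureTheory ProbabilityTheory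

namespace OVSMC

/-- The data-generating state-space model, the parametric state-space model and the
reparameterized proposal. Parameters are vectors of `ℝ^d`.

* `mbar x x'`, `gbar x y` : transition and emission densities of the model that generates the data,
  with initial law `chi`;
* `m θ x x'`, `g θ x y` : transition and emission densities of the parametric model;
* `q θ x x' y` : density at `x'` of the proposal kernel started from `(x, y)`;
* `R θ x y v` : reparameterization function, pushing the noise law `nu` forward to the proposal;
* `u` : the point at which the resampled particles are initialized. -/
structure Model (X Y E : Type*) [MeasurableSpace X] [MeasurableSpace Y] [MeasurableSpace E]
    (d : ℕ) where
  mu : Measure X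
  eta : Measure Y
  nu : Measure E
  mu_sigmaFinite : SigmaFinite mu
  eta_sigmaFinite : SigmaFinite eta
  nu_prob : IsProbabilityMeasure nu
  chi : Measure X
  chi_prob : IsProbabilityMeasure chi
  u : X
  mbar : X → X → ℝ
  gbar : X → Y → ℝ
  m : EuclideanSpace ℝ (Fin d) → X → X → ℝ
  g : EuclideanSpace ℝ (Fin d) → X → Y → ℝ
  q : EuclideanSpace ℝ (Fin d) → X → X → Y → ℝ
  R : EuclideanSpace ℝ (Fin d) → X → Y → E → X
  mbar_meas : Measurable fun p : X × X => mbar p.1 p.2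
  gbar_meas : Measurable fun p : X × Y => gbar p.1 p.2
  m_meas : ∀ θ, Measurable fun p : X × X => m θ p.1 p.2
  g_meas : ∀ θ, Measurable fun p : X × Y => g θ p.1 p.2
  q_meas : ∀ θ, Measurable fun p : X × X × Y => q θ p.1 p.2.1 p.2.2
  R_meas : ∀ θ, Measurable fun p : X × Y × E => R θ p.1 p.2.1 p.2.2
  mbar_nonneg : ∀ x x', 0 ≤ mbar x x'
  gbar_nonneg : ∀ x y, 0 ≤ gbar x y
  m_nonneg : ∀ θ x x', 0 ≤ m θ x x'
  g_nonneg : ∀ θ x y, 0 ≤ g θ x y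
  q_nonneg : ∀ θ x x' y, 0 ≤ q θ x x' y
  mbar_density : ∀ x, ∫⁻ x', ENNReal.ofReal (mbar x x') ∂mu = 1
  gbar_density : ∀ x, ∫⁻ y, ENNReal.ofReal (gbar x y) ∂eta = 1
  m_density : ∀ θ x, ∫⁻ x', ENNReal.ofReal (m θ x x') ∂mu = 1
  g_density : ∀ θ x, ∫⁻ y, ENNReal.ofReal (g θ x y) ∂eta = 1
  q_density : ∀ θ x y, ∫⁻ x', ENNReal.ofReal (q θ x x' y) ∂mu = 1
  reparam : ∀ θ x y,
    nu.map (R θ x y) = mu.withDensity fun x' => ENNReal.ofReal (q θ x x' y)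

attribute [instance] Model.mu_sigmaFinite Model.eta_sigmaFinite Model.nu_prob Model.chi_prob

/-- State space of the extended chain: `((x, y), (resampled particles, noise variables))`. -/
abbrev State (X Y E : Type*) (N : ℕ) : Type _ := (X × Y) × ((Fin N → X) × (Fin N → E))

namespace Model

variable {X Y E : Type*} [MeasurableSpace X] [MeasurableSpace Y] [MeasurableSpace E] {d : ℕ}

/-- Strong mixing with constant `ε`. -/
structure StrongMixing (S : Model X Y E d) (ε : ℝ) : Prop where
  mbar_mem : ∀ x x', ε ≤ S.mbar x x' ∧ S.mbar x x' ≤ 1 / ε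
  m_mem : ∀ θ x x', ε ≤ S.m θ x x' ∧ S.m θ x x' ≤ 1 / ε
  g_mem : ∀ θ x y, ε ≤ S.g θ x y ∧ S.g θ x y ≤ 1 / ε
  q_mem : ∀ θ x x' y, ε ≤ S.q θ x x' y ∧ S.q θ x x' y ≤ 1 / ε

/-- `θ ↦ m_θ(x, R_θ(x, y, v))`. -/
def mR (S : Model X Y E d) (x : X) (y : Y) (v : E) (θ : EuclideanSpace ℝ (Fin d)) : ℝ :=
  S.m θ x (S.R θ x y v)

/-- `θ ↦ g_θ(R_θ(x, y, v), y)`. -/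
def gR (S : Model X Y E d) (x : X) (y : Y) (v : E) (θ : EuclideanSpace ℝ (Fin d)) : ℝ :=
  S.g θ (S.R θ x y v) y

/-- `θ ↦ q_θ(x, R_θ(x, y, v), y)`. -/
def qR (S : Model X Y E d) (x : X) (y : Y) (v : E) (θ : EuclideanSpace ℝ (Fin d)) : ℝ :=
  S.q θ x (S.R θ x y v) y

/-- Bounded and Lipschitz gradients in `θ`, with constant `κ`. -/
structure LipschitzGradients (S : Model X Y E d) (κ : ℝ) : Prop where
  mR_diff : ∀ x y v, Differentiable ℝ (S.mR x y v)
  gR_diff : ∀ x y v, Differentiable ℝ (S.gR x y v)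
  qR_diff : ∀ x y v, Differentiable ℝ (S.qR x y v)
  mR_grad_le : ∀ x y v θ, ‖gradient (S.mR x y v) θ‖ ≤ κ
  gR_grad_le : ∀ x y v θ, ‖gradient (S.gR x y v) θ‖ ≤ κ
  qR_grad_le : ∀ x y v θ, ‖gradient (S.qR x y v) θ‖ ≤ κ
  m_lip : ∀ x x' θ θ', |S.m θ x x' - S.m θ' x x'| ≤ κ * ‖θ - θ'‖
  g_lip : ∀ x y θ θ', |S.g θ x y - S.g θ' x y| ≤ κ * ‖θ - θ'‖
  q_lip : ∀ x x' y θ θ', |S.q θ x x' y - S.q θ' x x' y| ≤ κ * ‖θ - θ'‖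
  mR_lip : ∀ x y v θ θ', |S.mR x y v θ - S.mR x y v θ'| ≤ κ * ‖θ - θ'‖
  gR_lip : ∀ x y v θ θ', |S.gR x y v θ - S.gR x y v θ'| ≤ κ * ‖θ - θ'‖
  qR_lip : ∀ x y v θ θ', |S.qR x y v θ - S.qR x y v θ'| ≤ κ * ‖θ - θ'‖
  mR_grad_lip : ∀ x y v θ θ',
    ‖gradient (S.mR x y v) θ - gradient (S.mR x y v) θ'‖ ≤ κ * ‖θ - θ'‖
  gR_grad_lip : ∀ x y v θ θ',
    ‖gradient (S.gR x y v) θ - gradient (S.gR x y v) θ'‖ ≤ κ * ‖θ - θ'‖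
  qR_grad_lip : ∀ x y v θ θ',
    ‖gradient (S.qR x y v) θ - gradient (S.qR x y v) θ'‖ ≤ κ * ‖θ - θ'‖

/-- Importance weight `m_θ(x, x') g_θ(x', y) / q_θ(x, x', y)`. -/
noncomputable def weight (S : Model X Y E d) (θ : EuclideanSpace ℝ (Fin d)) (x x' : X) (y : Y) :
    ℝ :=
  S.m θ x x' * S.g θ x' y / S.q θ x x' y

/-- Probability that a resampling draw selects index `i`, when the parent particles are `xt`, the
mutated particles are `xp` and the observation is `y`. -/
noncomputable def resampProb (S : Model X Y E d) {N : ℕ} (θ : EuclideanSpace ℝ (Fin d))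
    (xt xp : Fin N → X) (y : Y) (i : Fin N) : ℝ :=
  S.weight θ (xt i) (xp i) y / ∑ l, S.weight θ (xt l) (xp l) y

/-- The transition law `T_θ(z, ·)` of the extended chain. Given `z = ((x, y), (xt, v))`: the
data-generating model moves to `(x', y')`, the mutated particles `xp k` are drawn from the proposal
started from `(xt k, y)`, ancestor indices `I j` are drawn independently from the
normalized weights, fresh noise `v'` is drawn from `nu^N`, and the new state is
`((x', y'), (xp ∘ I, v'))`. The sum over `I` is the expansion of the product over `j` of
the mixtures `∑ i, resampProb i • δ_{xp i}`. -/
noncomputable def T (S : Model X Y E d) (N : ℕ) (θ : EuclideanSpace ℝ (Fin d))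
    (z : State X Y E N) : Measure (State X Y E N) :=
  ∑ I : Fin N → Fin N,
    (((S.mu.prod S.eta).prod
        ((Measure.pi fun _ : Fin N => S.mu).prod (Measure.pi fun _ : Fin N => S.nu))).withDensity
      fun p => ENNReal.ofReal
        (S.mbar z.1.1 p.1.1 * S.gbar p.1.1 p.1.2 *
          (∏ k, S.q θ (z.2.1 k) (p.2.1 k) z.1.2) *
          ∏ j, S.resampProb θ z.2.1 p.2.1 z.1.2 (I j))).map
      fun p => (p.1, (fun j => p.2.1 (I j), p.2.2))

/-- Initial law: `X_0 ~ chi`, `Y_0` drawn from `gbar X_0`, all resampled particles equal to `u`,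
and independent noise variables. -/
noncomputable def initLaw (S : Model X Y E d) (N : ℕ) : Measure (State X Y E N) :=
  ((S.chi.prod S.eta).withDensity fun p => ENNReal.ofReal (S.gbar p.1 p.2)).prod
    ((Measure.dirac fun _ : Fin N => S.u).prod (Measure.pi fun _ : Fin N => S.nu))

/-- `H_θ(z)`, the gradient in `θ` of the logarithm of the total weight. -/
noncomputable def H (S : Model X Y E d) (N : ℕ) (θ : EuclideanSpace ℝ (Fin d))
    (z : State X Y E N) : EuclideanSpace ℝ (Fin d) :=
  gradient (fun ϑ => Real.log
    (∑ i, S.weight ϑ (z.2.1 i) (S.R ϑ (z.2.1 i) z.1.2 (z.2.2 i)) z.1.2)) θ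

/-- `π` is a stationary distribution of `T_θ`. -/
structure IsStationary (S : Model X Y E d) (N : ℕ) (θ : EuclideanSpace ℝ (Fin d))
    (π : Measure (State X Y E N)) : Prop where
  prob : IsProbabilityMeasure π
  invariant : ∀ A, MeasurableSet A → ∫⁻ z, S.T N θ z A ∂π = π A

open Classical in
/-- The stationary distribution of `T_θ` (the zero measure if there is none). -/
noncomputable def stat (S : Model X Y E d) (N : ℕ) (θ : EuclideanSpace ℝ (Fin d)) :
    Measure (State X Y E N) :=
  if h : ∃ π, S.IsStationary N θ π then h.choose else 0

/-- The mean field `h(θ) = ∫ H_θ dπ_θ`. -/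
noncomputable def meanField (S : Model X Y E d) (N : ℕ) (θ : EuclideanSpace ℝ (Fin d)) :
    EuclideanSpace ℝ (Fin d) :=
  ∫ z, S.H N θ z ∂S.stat N θ

/-- `α ≥ 1` bounds `H`, a solution `Hhat` of the Poisson equation and `T Hhat`, and is a Lipschitz
constant in `θ` of `H`, `T Hhat` and the mean field. -/
structure IsPoissonConstant (S : Model X Y E d) (N : ℕ) (α : ℝ) : Prop where
  one_le : 1 ≤ α
  exists_sol : ∃ Hhat : EuclideanSpace ℝ (Fin d) → State X Y E N → EuclideanSpace ℝ (Fin d),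
    (∀ θ, Measurable (Hhat θ)) ∧
    (∀ θ z, S.H N θ z - S.meanField N θ = Hhat θ z - ∫ z', Hhat θ z' ∂S.T N θ z) ∧
    (∀ θ z, ‖S.H N θ z‖ ≤ α ∧ ‖Hhat θ z‖ ≤ α ∧ ‖∫ z', Hhat θ z' ∂S.T N θ z‖ ≤ α) ∧
    (∀ θ θ' z, ‖S.H N θ z - S.H N θ' z‖ ≤ α * ‖θ - θ'‖ ∧
      ‖(∫ z', Hhat θ z' ∂S.T N θ z) - ∫ z', Hhat θ' z' ∂S.T N θ' z‖ ≤ α * ‖θ - θ'‖ ∧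
      ‖S.meanField N θ - S.meanField N θ'‖ ≤ α * ‖θ - θ'‖)

/-- The Robbins-Monro iterates along a trajectory `z` of the extended chain. -/
noncomputable def iter (S : Model X Y E d) (N : ℕ) (γ : ℕ → ℝ) (θ₀ : EuclideanSpace ℝ (Fin d))
    (z : ℕ → State X Y E N) : ℕ → EuclideanSpace ℝ (Fin d)
  | 0 => θ₀
  | t + 1 => S.iter N γ θ₀ z t + γ (t + 1) • S.H N (S.iter N γ θ₀ z t) (z (t + 1))

/-- `Z` is the state-dependent Markov chain of the algorithm: `Z_0` has the initial law, and given
`Z_0, …, Z_t` the variable `Z_{t+1}` has law `T_{θ_t}(Z_t, ·)`, where `θ_t` is the iterate computed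
from `Z_1, …, Z_t`. -/
structure IsChain (S : Model X Y E d) (N : ℕ) (γ : ℕ → ℝ) (θ₀ : EuclideanSpace ℝ (Fin d))
    {Ω : Type*} [MeasurableSpace Ω] (P : Measure Ω) (Z : ℕ → Ω → State X Y E N) : Prop where
  measurable : ∀ t, Measurable (Z t)
  init : P.map (Z 0) = S.initLaw N
  trans : ∀ (t : ℕ) (f : State X Y E N → ℝ), Measurable f → (∃ C, ∀ z, |f z| ≤ C) →
    P[fun ω => f (Z (t + 1) ω) | ⨆ (s : ℕ) (_ : s ≤ t), MeasurableSpace.comap (Z s) inferInstance]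
      =ᵐ[P] fun ω => ∫ z', f z' ∂S.T N (S.iter N γ θ₀ (fun s => Z s ω) t) (Z t ω)

end Model

/-- Positive nonincreasing step sizes `γ 1, γ 2, …` with regularity constants `a`, `a'`
(the value `γ 0` is irrelevant). -/
structure StepSizes (γ : ℕ → ℝ) (a a' : ℝ) : Prop where
  a_pos : 0 < a
  a'_pos : 0 < a'
  pos : ∀ t, 1 ≤ t → 0 < γ t
  anti : ∀ t, 1 ≤ t → γ (t + 1) ≤ γ t
  le_mul : ∀ t, 1 ≤ t → γ t ≤ a * γ (t + 1)
  sub_le : ∀ t, 1 ≤ t → γ t - γ (t + 1) ≤ a' * γ (t + 1) ^ 2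

/-- `τ` has the categorical distribution on `{0, …, t}` with weights `γ 1, …, γ (t + 1)`. -/
structure IsCategorical {Ω : Type*} [MeasurableSpace Ω] (P : Measure Ω) (γ : ℕ → ℝ) (t : ℕ)
    (τ : Ω → Fin (t + 1)) : Prop where
  measurable : Measurable τ
  prob : ∀ s : Fin (t + 1), P {ω | τ ω = s} =
    ENNReal.ofReal (γ (s + 1) / ∑ r ∈ Finset.range (t + 1), γ (r + 1))

/-- The step-size constant `c_h`. -/
noncomputable def cH (α a a' : ℝ) : ℝ := α * (a + 1) / 2 + α ^ 2 * (2 * a + 1) + α * a'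

end OVSMC

/-! Strong mixing gives a Doeblin minorization: all transition laws `T_θ(z, ·)` dominate one measure
`b`, the same for every `θ` and `z`, of mass `β` at least `minorMass ε N > 0`. Remove it, `Q_θ = T_θ
- b`, and form the potential kernel `G_θ = ∑ Q_θ^n`, of mass `1 / β`. Then `b G_θ` is an invariant
probability, and `u_θ = G_θ H_θ` satisfies `u_θ = H_θ + T_θ u_θ - ∫ u_θ ∂b`. Integrating against an
invariant law gives `h(θ) = ∫ u_θ ∂b`, so `u_θ` solves the Poisson equation; the same formula for
indicators gives uniqueness.

Since `b` is free of `θ`, the difference `w = u_θ - u_θ'` satisfies `w = (H_θ - H_θ') + (T_θ - T_θ')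
u_θ' + Q_θ w`. As `Q_θ` contracts the sup norm by `1 - β`, Lipschitz bounds for `H` and for `T` in
total variation pass to `u`, hence to `T u` and `h`. Both come from a calculus of bounded Lipschitz
functions applied to the densities and weights. This is `isPoissonConstant`.

For the algorithm, a Taylor bound for `V` gives `V(θ_{s+1}) - V(θ_s) ≥ γ_{s+1} ⟨h, H⟩ - α³
γ_{s+1}²`. The Poisson equation splits `⟨h, H⟩` into `‖h‖²`, a centred martingale increment, and the
remainder `⟨h, T Ĥ(Z_s) - T Ĥ(Z_{s+1})⟩`. Summation by parts (`sum_poisson_remainder_le`) bounds the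
weighted remainders by `2α² γ_1 + 2α³ ∑ γ²`. Taking expectations (`sum_integral_sq_norm_le`) and
averaging over `τ` gives a bound that implies both (a) and (b). -/

namespace OVSMC

/-! ### Doeblin minorization: invariant law and Poisson equation -/

section Doeblin

open scoped ENNReal

variable {Z : Type*} [MeasurableSpace Z]

/-- The part of a kernel that remains when a minorizing measure is removed. -/
noncomputable def residual (T : Kernel Z Z) (b : Measure Z) [IsFiniteMeasure b]
    (hb : ∀ z, b ≤ T z) : Kernel Z Z where
  toFun z := T z - b
  measurable' := by
    refine Measure.measurable_of_measurable_coe _ fun s hs => ?_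
    simp_rw [fun z => Measure.sub_apply hs (hb z)]
    exact (T.measurable_coe hs).sub_const _

lemma residual_apply (T : Kernel Z Z) (b : Measure Z) [IsFiniteMeasure b]
    (hb : ∀ z, b ≤ T z) (z : Z) : residual T b hb z = T z - b := rfl

lemma residual_add (T : Kernel Z Z) (b : Measure Z) [IsFiniteMeasure b]
    (hb : ∀ z, b ≤ T z) (z : Z) : residual T b hb z + b = T z := by
  rw [residual_apply, Measure.sub_add_cancel_of_le (hb z)]

/-- The potential kernel of the residual kernel. -/
noncomputable def potential (T : Kernel Z Z) (b : Measure Z) [IsFiniteMeasure b]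
    (hb : ∀ z, b ≤ T z) : Kernel Z Z :=
  Kernel.sum fun n => residual T b hb ^ n

variable (T : Kernel Z Z) (b : Measure Z) [IsFiniteMeasure b] (hb : ∀ z, b ≤ T z)

/-- Splits off the term `n = 0`, with the residual step taken first; this is what yields `u = f + Q
u`. The companion identity takes the residual step last and serves for the invariance of `b G`. -/
lemma potential_eq_left : potential T b hb = Kernel.id + potential T b hb ∘ₖ residual T b hb := by
  conv_lhs => rw [potential]
  rw [potential, Kernel.comp_sum_left]
  ext z s hs
  rw [Kernel.sum_apply' _ _ hs, tsum_eq_zero_add' ENNReal.summable, add_apply,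
    Measure.add_apply, Kernel.sum_apply' _ _ hs]
  simp only [pow_succ]
  rfl

lemma potential_eq_right : potential T b hb = Kernel.id + residual T b hb ∘ₖ potential T b hb := by
  conv_lhs => rw [potential]
  rw [potential, Kernel.comp_sum_right]
  ext z s hs
  rw [Kernel.sum_apply' _ _ hs, tsum_eq_zero_add' ENNReal.summable, add_apply,
    Measure.add_apply, Kernel.sum_apply' _ _ hs]
  simp only [pow_succ']
  rfl

variable [IsMarkovKernel T]

instance : IsFiniteKernel (residual T b hb) :=
  ⟨1, ENNReal.one_lt_top, fun z => by
    rw [residual_apply]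
    exact (Measure.sub_le _).trans prob_le_one⟩

lemma residual_univ (z : Z) : residual T b hb z Set.univ = 1 - b Set.univ := by
  rw [residual_apply, Measure.sub_apply MeasurableSet.univ (hb z), measure_univ]

lemma residual_pow_univ (n : ℕ) (z : Z) :
    (residual T b hb ^ n) z Set.univ = (1 - b Set.univ) ^ n := by
  induction n generalizing z with
  | zero => simp [show (1 : Kernel Z Z) = Kernel.id from rfl]
  | succ n ih =>
    rw [Kernel.pow_succ_apply_eq_lintegral _ _ _ MeasurableSet.univ]
    simp [ih, residual_univ, pow_succ']

/-- Every residual step keeps the fraction `1 - b(Z)` of the mass, so the masses form a geometric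
series. -/
lemma potential_univ (z : Z) : potential T b hb z Set.univ = (b Set.univ)⁻¹ := by
  rw [potential, Kernel.sum_apply' _ _ MeasurableSet.univ]
  simp_rw [residual_pow_univ]
  rw [ENNReal.tsum_geometric, ENNReal.sub_sub_cancel ENNReal.one_ne_top]
  exact (hb z Set.univ).trans prob_le_one

lemma isFiniteKernel_potential (h0 : b Set.univ ≠ 0) : IsFiniteKernel (potential T b hb) :=
  ⟨(b Set.univ)⁻¹, by simpa [lt_top_iff_ne_top] using h0, fun z => (potential_univ T b hb z).le⟩

/-- Existence of an invariant distribution under a Doeblin minorization. -/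
lemma exists_invariant_of_minorized (hb : ∀ z, b ≤ T z) (h0 : b Set.univ ≠ 0) :
    ∃ π : Measure Z, IsProbabilityMeasure π ∧ ∀ A, MeasurableSet A → ∫⁻ z, T z A ∂π = π A := by
  -- The candidate is `b G`. Its mass is `b(Z) * b(Z)⁻¹ = 1`, and `(b G) T = (b G) Q + b = b G`.
  have hp : IsProbabilityMeasure (potential T b hb ∘ₘ b) := by
    constructor
    rw [Measure.bind_apply MeasurableSet.univ (Kernel.aemeasurable _)]
    simp_rw [potential_univ]
    rw [lintegral_const, ENNReal.inv_mul_cancel h0 (measure_ne_top _ _)]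
  refine ⟨potential T b hb ∘ₘ b, hp, fun A hA => ?_⟩
  have h1 : ∀ z, T z A = residual T b hb z A + b A := fun z => by
    rw [← residual_add T b hb z, Measure.add_apply]
  simp_rw [h1]
  rw [lintegral_add_right _ measurable_const, lintegral_const, measure_univ, mul_one]
  conv_rhs => rw [potential_eq_right]
  rw [Measure.add_comp, Measure.add_apply, Measure.id_comp, ← Measure.comp_assoc,
    Measure.bind_apply hA (Kernel.aemeasurable _), add_comm]

section Poisson

variable {F : Type*} [NormedAddCommGroup F]

lemma integrable_of_bound {μ : Measure Z} [IsFiniteMeasure μ] {f : Z → F}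
    (hf : StronglyMeasurable f) {C : ℝ} (hC : ∀ z, ‖f z‖ ≤ C) : Integrable f μ :=
  Integrable.of_bound hf.aestronglyMeasurable C (ae_of_all _ hC)

variable [NormedSpace ℝ F]

lemma norm_integral_le_mul {μ : Measure Z} [IsFiniteMeasure μ] {f : Z → F} {C : ℝ}
    (hC : ∀ z, ‖f z‖ ≤ C) : ‖∫ z, f z ∂μ‖ ≤ C * μ.real Set.univ :=
  norm_integral_le_of_norm_le_const (ae_of_all _ hC)

/-- The solution of the Poisson equation given by the potential kernel. -/
noncomputable def poissonSol (f : Z → F) (z : Z) : F := ∫ z', f z' ∂potential T b hb z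

variable {T b hb} {f : Z → F} {C : ℝ}

lemma stronglyMeasurable_poissonSol (h0 : b Set.univ ≠ 0) (hf : StronglyMeasurable f) :
    StronglyMeasurable (poissonSol T b hb f) := by
  have := isFiniteKernel_potential T b hb h0
  exact hf.integral_kernel

lemma norm_poissonSol_le (h0 : b Set.univ ≠ 0) (hC : ∀ z, ‖f z‖ ≤ C) (z : Z) :
    ‖poissonSol T b hb f z‖ ≤ C / b.real Set.univ := by
  have := isFiniteKernel_potential T b hb h0
  refine (norm_integral_le_mul hC).trans_eq ?_
  rw [measureReal_def, potential_univ, ENNReal.toReal_inv, div_eq_mul_inv, measureReal_def]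

/-- From `G = 1 + Q G` one has `u = f + Q u`; then `Q = T - b` is expanded. -/
lemma poissonSol_eq [CompleteSpace F] (h0 : b Set.univ ≠ 0) (hf : StronglyMeasurable f)
    (hC : ∀ z, ‖f z‖ ≤ C) (z : Z) : poissonSol T b hb f z =
      f z + ∫ z', poissonSol T b hb f z' ∂T z - ∫ z', poissonSol T b hb f z' ∂b := by
  have := isFiniteKernel_potential T b hb h0
  have hu := stronglyMeasurable_poissonSol (hb := hb) h0 hf
  have hub := norm_poissonSol_le (hb := hb) h0 hC
  have h1 : poissonSol T b hb f z = f z + ∫ z', poissonSol T b hb f z' ∂residual T b hb z := by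
    conv_lhs => rw [poissonSol, potential_eq_left]
    rw [add_apply, integral_add_measure (integrable_of_bound hf hC)
      (integrable_of_bound hf hC), Kernel.id_apply, integral_dirac' _ _ hf,
      Kernel.integral_comp (integrable_of_bound hf hC)]
    rfl
  rw [h1, add_sub_assoc]
  congr 1
  rw [← residual_add T b hb z, integral_add_measure (integrable_of_bound hu hub)
    (integrable_of_bound hu hub), add_sub_cancel_right]

/-- Integrating `f = u - T u + ∫ u ∂b` against `π`, the first two terms cancel by invariance. The
right side does not involve `π`, which gives uniqueness; later it expresses the mean field as an
integral against a measure free of `θ`. -/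
lemma integral_eq_of_invariant [CompleteSpace F] (h0 : b Set.univ ≠ 0)
    (hf : StronglyMeasurable f) (hC : ∀ z, ‖f z‖ ≤ C) {π : Measure Z} [IsProbabilityMeasure π]
    (hπ : ∀ A, MeasurableSet A → ∫⁻ z, T z A ∂π = π A) :
    ∫ z, f z ∂π = ∫ z, poissonSol T b hb f z ∂b := by
  have hu := stronglyMeasurable_poissonSol (hb := hb) h0 hf
  have hub := norm_poissonSol_le (hb := hb) h0 hC
  have hTπ : T ∘ₘ π = π := by
    ext A hA
    rw [Measure.bind_apply hA (Kernel.aemeasurable _), hπ A hA]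
  have h1 : ∫ z, ∫ z', poissonSol T b hb f z' ∂T z ∂π = ∫ z, poissonSol T b hb f z ∂π := by
    have hc : (T ∘ₖ Kernel.const Unit π) () = π := by
      rw [← Measure.comp_eq_comp_const_apply, hTπ]
    conv_rhs => rw [← hc]
    rw [Kernel.integral_comp (by rw [hc]; exact integrable_of_bound hu hub), Kernel.const_apply]
  have hi : Integrable (fun z => ∫ z', poissonSol T b hb f z' ∂T z) π :=
    integrable_of_bound (C := C / b.real Set.univ) hu.integral_kernel fun z =>
      (norm_integral_le_mul hub).trans_eq (by rw [probReal_univ (μ := T z), mul_one])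
  have h2 : ∀ z, f z = poissonSol T b hb f z - ∫ z', poissonSol T b hb f z' ∂T z
      + ∫ z', poissonSol T b hb f z' ∂b := fun z => by
    conv_rhs => lhs; lhs; rw [poissonSol_eq (hb := hb) h0 hf hC z]
    abel
  rw [integral_congr_ae (ae_of_all _ h2), integral_add (by exact (integrable_of_bound hu hub).sub hi)
    (integrable_const _), integral_sub (integrable_of_bound hu hub) hi, h1]
  simp

/-- The invariant distribution is unique under a Doeblin minorization. -/
lemma invariant_unique_of_minorized (hb : ∀ z, b ≤ T z) (h0 : b Set.univ ≠ 0) {π π' : Measure Z}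
    [IsProbabilityMeasure π] [IsProbabilityMeasure π']
    (hπ : ∀ A, MeasurableSet A → ∫⁻ z, T z A ∂π = π A)
    (hπ' : ∀ A, MeasurableSet A → ∫⁻ z, T z A ∂π' = π' A) : π = π' := by
  ext A hA
  have hf : StronglyMeasurable (A.indicator (1 : Z → ℝ)) := stronglyMeasurable_one.indicator hA
  have hC : ∀ z, ‖A.indicator (1 : Z → ℝ) z‖ ≤ 1 := fun z => by
    by_cases h : z ∈ A <;> simp [h]
  have h := (integral_eq_of_invariant (hb := hb) h0 hf hC hπ).trans
    (integral_eq_of_invariant h0 hf hC hπ').symm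
  rw [integral_indicator_one hA, integral_indicator_one hA] at h
  exact (measureReal_eq_measureReal_iff).1 h

/-- A bounded function that equals a bounded term plus its integral against the residual kernel. -/
lemma norm_le_of_eq_add_residual {w g : Z → F} {C c : ℝ} (h0 : b Set.univ ≠ 0)
    (hw : ∀ z, ‖w z‖ ≤ C) (hg : ∀ z, ‖g z‖ ≤ c)
    (h : ∀ z, w z = g z + ∫ z', w z' ∂residual T b hb z) (z : Z) :
    ‖w z‖ ≤ c / b.real Set.univ := by
  have : Nonempty Z := ⟨z⟩
  -- The a priori bound `C` only makes the supremum `D` finite, so that `D ≤ c + D (1 - b(Z))` can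
  -- be solved for `D`.
  have hbd : BddAbove (Set.range fun z => ‖w z‖) := ⟨C, by rintro _ ⟨z, rfl⟩; exact hw z⟩
  have hpos : 0 < b.real Set.univ := ENNReal.toReal_pos h0 (measure_ne_top _ _)
  have hle1 : b Set.univ ≤ 1 := (hb z Set.univ).trans prob_le_one
  set D := ⨆ z, ‖w z‖
  have hD : D ≤ c + D * (1 - b.real Set.univ) := by
    refine ciSup_le fun z => ?_
    rw [h z]
    refine (norm_add_le _ _).trans (add_le_add (hg z) ?_)
    refine (norm_integral_le_mul fun z => le_ciSup hbd z).trans_eq ?_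
    rw [measureReal_def, residual_univ, ENNReal.toReal_sub_of_le hle1 ENNReal.one_ne_top]
    rfl
  refine (le_ciSup hbd z).trans ?_
  rw [le_div_iff₀ hpos]
  linarith

end Poisson

end Doeblin

/-! ### Calculus of bounded Lipschitz and smooth functions -/

/-- A function that is bounded by `A` and has Lipschitz constant `A`. -/
structure BoundedLip {F G : Type*} [SeminormedAddCommGroup F] [SeminormedAddCommGroup G]
    (f : F → G) (A : ℝ) : Prop where
  bound : ∀ x, ‖f x‖ ≤ A
  lip : ∀ x y, ‖f x - f y‖ ≤ A * ‖x - y‖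

namespace BoundedLip

variable {F G : Type*} [SeminormedAddCommGroup F] [SeminormedAddCommGroup G] {f g : F → G}
  {A B : ℝ}

lemma nonneg (hf : BoundedLip f A) : 0 ≤ A := (norm_nonneg _).trans (hf.bound 0)

lemma mono (hf : BoundedLip f A) (h : A ≤ B) : BoundedLip f B :=
  ⟨fun x => (hf.bound x).trans h, fun x y => (hf.lip x y).trans (by gcongr)⟩

lemma neg (hf : BoundedLip f A) : BoundedLip (fun x => -f x) A :=
  ⟨fun x => (norm_neg _).trans_le (hf.bound x), fun x y => by
    rw [← neg_sub', norm_neg]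
    exact hf.lip x y⟩

lemma add (hf : BoundedLip f A) (hg : BoundedLip g B) :
    BoundedLip (fun x => f x + g x) (A + B) :=
  ⟨fun x => (norm_add_le _ _).trans (add_le_add (hf.bound x) (hg.bound x)), fun x y => by
    rw [add_sub_add_comm, add_mul]
    exact (norm_add_le _ _).trans (add_le_add (hf.lip x y) (hg.lip x y))⟩

/-- The factor `2` comes from varying the two factors one at a time; the bound on the values has
room to spare. -/
lemma smul [NormedSpace ℝ G] {f : F → ℝ} (hf : BoundedLip f A) (hg : BoundedLip g B) :
    BoundedLip (fun x => f x • g x) (2 * A * B) := by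
  have hA := hf.nonneg
  have hB := hg.nonneg
  refine ⟨fun x => ?_, fun x y => ?_⟩
  · rw [norm_smul]
    have := mul_le_mul (hf.bound x) (hg.bound x) (norm_nonneg _) hA
    nlinarith [mul_nonneg hA hB]
  · have h1 : f x • g x - f y • g y = (f x - f y) • g x + f y • (g x - g y) := by
      rw [sub_smul, smul_sub]
      abel
    rw [h1]
    refine (norm_add_le _ _).trans ?_
    rw [norm_smul, norm_smul]
    have h2 := mul_le_mul (hf.lip x y) (hg.bound x) (norm_nonneg _) (by positivity)
    have h3 := mul_le_mul (hf.bound y) (hg.lip x y) (norm_nonneg _) hA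
    linarith

lemma mul {f g : F → ℝ} (hf : BoundedLip f A) (hg : BoundedLip g B) :
    BoundedLip (fun x => f x * g x) (2 * A * B) := hf.smul hg

lemma prod {ι : Type*} (s : Finset ι) {f : ι → F → ℝ} (hf : ∀ i ∈ s, BoundedLip (f i) A) :
    BoundedLip (fun x => ∏ i ∈ s, f i x) ((2 * A) ^ s.card) := by
  classical
  induction s using Finset.induction_on with
  | empty => exact ⟨by simp, by simp⟩
  | insert i s hi ih =>
    simp_rw [Finset.prod_insert hi, Finset.card_insert_of_notMem hi, pow_succ']
    exact (hf i (Finset.mem_insert_self i s)).mul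
      (ih fun j hj => hf j (Finset.mem_insert_of_mem hj))

lemma sum {ι : Type*} (s : Finset ι) {f : ι → F → G} (hf : ∀ i ∈ s, BoundedLip (f i) A) :
    BoundedLip (fun x => ∑ i ∈ s, f i x) (s.card * A) := by
  refine ⟨fun x => ?_, fun x y => ?_⟩
  · simpa using norm_sum_le_of_le s fun i hi => (hf i hi).bound x
  · rw [← Finset.sum_sub_distrib]
    simpa [mul_assoc] using norm_sum_le_of_le s fun i hi => (hf i hi).lip x y

/-- The summand `1 / e` bounds the values and `A / e ^ 2` is a Lipschitz constant. -/
lemma inv {f : F → ℝ} {e : ℝ} (he : 0 < e) (hf : BoundedLip f A) (hfe : ∀ x, e ≤ f x) :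
    BoundedLip (fun x => (f x)⁻¹) (1 / e + A / e ^ 2) := by
  have hA := hf.nonneg
  refine ⟨fun x => ?_, fun x y => ?_⟩
  · have hx := he.trans_le (hfe x)
    rw [Real.norm_of_nonneg (inv_pos.2 hx).le, ← one_div]
    have := one_div_le_one_div_of_le he (hfe x)
    have : 0 ≤ A / e ^ 2 := by positivity
    linarith
  · have hx := he.trans_le (hfe x)
    have hy := he.trans_le (hfe y)
    have h1 : (f x)⁻¹ - (f y)⁻¹ = (f y - f x) / (f x * f y) := by field_simp
    rw [h1, norm_div, Real.norm_of_nonneg (mul_pos hx hy).le, norm_sub_rev]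
    calc ‖f x - f y‖ / (f x * f y) ≤ A * ‖x - y‖ / (e * e) := by
          gcongr
          exacts [hf.lip x y, hfe x, hfe y]
      _ = A / e ^ 2 * ‖x - y‖ := by rw [pow_two]; ring
      _ ≤ (1 / e + A / e ^ 2) * ‖x - y‖ := by
          have : 0 ≤ 1 / e := by positivity
          gcongr
          linarith

end BoundedLip

/-- A differentiable function such that the function and its derivative are bounded by `A` and
have Lipschitz constant `A`. -/
structure SmoothBound {F : Type*} [NormedAddCommGroup F] [NormedSpace ℝ F] (f : F → ℝ) (A : ℝ) :
    Prop where
  diff : Differentiable ℝ f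
  val : BoundedLip f A
  der : BoundedLip (fderiv ℝ f) A

namespace SmoothBound

variable {F : Type*} [NormedAddCommGroup F] [NormedSpace ℝ F] {f g : F → ℝ} {A B : ℝ}

lemma mul (hf : SmoothBound f A) (hg : SmoothBound g B) :
    SmoothBound (fun x => f x * g x) (4 * A * B) := by
  have := hf.val.nonneg
  have := hg.val.nonneg
  refine ⟨hf.diff.mul hg.diff, (hf.val.mul hg.val).mono (by gcongr; norm_num), ?_⟩
  have h : fderiv ℝ (fun x => f x * g x) = fun x => f x • fderiv ℝ g x + g x • fderiv ℝ f x :=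
    funext fun x => fderiv_fun_mul (hf.diff x) (hg.diff x)
  rw [h]
  exact ((hf.val.smul hg.der).add (hg.val.smul hf.der)).mono (by linarith)

lemma sum {ι : Type*} (s : Finset ι) {f : ι → F → ℝ} (hf : ∀ i ∈ s, SmoothBound (f i) A) :
    SmoothBound (fun x => ∑ i ∈ s, f i x) (s.card * A) := by
  refine ⟨Differentiable.fun_sum fun i hi => (hf i hi).diff,
    BoundedLip.sum s fun i hi => (hf i hi).val, ?_⟩
  have h : fderiv ℝ (fun x => ∑ i ∈ s, f i x) = fun x => ∑ i ∈ s, fderiv ℝ (f i) x :=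
    funext fun x => fderiv_fun_sum fun i hi => (hf i hi).diff x
  rw [h]
  exact BoundedLip.sum s fun i hi => (hf i hi).der

/-- The first two summands control the inverse itself; the last one controls its derivative `-(f⁻¹ *
f⁻¹) • f'` by two uses of the product rule for `BoundedLip`. -/
lemma inv {e : ℝ} (he : 0 < e) (hf : SmoothBound f A) (hfe : ∀ x, e ≤ f x) :
    SmoothBound (fun x => (f x)⁻¹)
      (1 / e + A / e ^ 2 + 2 * (2 * (1 / e + A / e ^ 2) * (1 / e + A / e ^ 2)) * A) := by
  have hA := hf.val.nonneg
  have h0 : ∀ x, f x ≠ 0 := fun x => (he.trans_le (hfe x)).ne'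
  have hi := hf.val.inv he hfe
  refine ⟨hf.diff.inv h0, hi.mono (le_add_of_nonneg_right (by positivity)), ?_⟩
  have h : fderiv ℝ (fun x => (f x)⁻¹) = fun x => -(((f x)⁻¹ * (f x)⁻¹) • fderiv ℝ f x) := by
    funext x
    have hx := (hasDerivAt_inv (h0 x)).comp_hasFDerivAt x (hf.diff x).hasFDerivAt
    rw [show (fun x => (f x)⁻¹) = Inv.inv ∘ f from rfl, hx.fderiv, neg_smul, pow_two, mul_inv]
  rw [h]
  exact ((hi.mul hi).smul hf.der).neg.mono (le_add_of_nonneg_left (by positivity))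

lemma boundedLip_fderiv_log {e : ℝ} (he : 0 < e) (hf : SmoothBound f A) (hfe : ∀ x, e ≤ f x) :
    BoundedLip (fderiv ℝ fun x => Real.log (f x)) (2 * (1 / e + A / e ^ 2) * A) := by
  have h : (fderiv ℝ fun x => Real.log (f x)) = fun x => (f x)⁻¹ • fderiv ℝ f x :=
    funext fun x => fderiv.log (hf.diff x) (he.trans_le (hfe x)).ne'
  rw [h]
  exact (hf.val.inv he hfe).smul hf.der

end SmoothBound

/-! ### Densities of the extended chain and their integrals -/

namespace Model

variable {X Y E : Type*} [MeasurableSpace X] [MeasurableSpace Y] [MeasurableSpace E] {d : ℕ}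

/-- A density of total mass one forces `Y` to be nonempty, a probability measure does so for `E`. A
state is needed to extract statements free of `z` from bounds that hold at each `z`. -/
lemma nonempty_state (S : Model X Y E d) (N : ℕ) : Nonempty (State X Y E N) := by
  have hY : Nonempty Y := by
    by_contra h
    rw [not_nonempty_iff] at h
    have := S.gbar_density S.u
    rw [Measure.eq_zero_of_isEmpty S.eta] at this
    simp at this
  have hE : Nonempty E := S.nu.nonempty_of_neZero
  exact ⟨((S.u, hY.some), (fun _ => S.u, fun _ => hE.some))⟩

section Densities

variable (S : Model X Y E d) {N : ℕ}

/-- The reference measure for the new data point, the mutated particles and the new noise. -/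
noncomputable def refMeasure (N : ℕ) :
    Measure ((X × Y) × ((Fin N → X) × (Fin N → E))) :=
  (S.mu.prod S.eta).prod
    ((Measure.pi fun _ : Fin N => S.mu).prod (Measure.pi fun _ : Fin N => S.nu))

instance : SFinite (S.refMeasure N) := by unfold refMeasure; infer_instance

/-- Resampling according to the ancestor indices `I`. -/
def resample (I : Fin N → Fin N) (p : State X Y E N) : State X Y E N :=
  (p.1, (fun j => p.2.1 (I j), p.2.2))

/-- The density of the new data point. -/
def dataDensity (z p : State X Y E N) : ℝ := S.mbar z.1.1 p.1.1 * S.gbar p.1.1 p.1.2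

/-- The density of the mutated particles and the ancestor indices. -/
noncomputable def particleDensity (θ : EuclideanSpace ℝ (Fin d)) (I : Fin N → Fin N)
    (z p : State X Y E N) : ℝ :=
  (∏ k, S.q θ (z.2.1 k) (p.2.1 k) z.1.2) * ∏ j, S.resampProb θ z.2.1 p.2.1 z.1.2 (I j)

lemma T_eq (θ : EuclideanSpace ℝ (Fin d)) (z : State X Y E N) :
    S.T N θ z = ∑ I : Fin N → Fin N, ((S.refMeasure N).withDensity fun p =>
      ENNReal.ofReal (S.dataDensity z p * S.particleDensity θ I z p)).map (resample I) := by
  simp_rw [T, particleDensity, dataDensity, ← mul_assoc]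
  rfl

@[fun_prop]
lemma measurable_resample (I : Fin N → Fin N) :
    Measurable (resample I : State X Y E N → State X Y E N) := by
  unfold resample
  fun_prop

lemma measurable_dataDensity :
    Measurable fun w : State X Y E N × State X Y E N => S.dataDensity w.1 w.2 := by
  unfold dataDensity
  exact (S.mbar_meas.comp (f := fun w : State X Y E N × State X Y E N => (w.1.1.1, w.2.1.1))
    (by fun_prop)).mul (S.gbar_meas.comp
      (f := fun w : State X Y E N × State X Y E N => (w.2.1.1, w.2.1.2)) (by fun_prop))

lemma measurable_weight (θ : EuclideanSpace ℝ (Fin d)) :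
    Measurable fun w : X × X × Y => S.weight θ w.1 w.2.1 w.2.2 := by
  unfold weight
  exact (((S.m_meas θ).comp (f := fun w : X × X × Y => (w.1, w.2.1)) (by fun_prop)).mul
    ((S.g_meas θ).comp (f := fun w : X × X × Y => (w.2.1, w.2.2)) (by fun_prop))).div
    (S.q_meas θ)

lemma measurable_particleDensity (θ : EuclideanSpace ℝ (Fin d)) (I : Fin N → Fin N) :
    Measurable fun w : State X Y E N × State X Y E N => S.particleDensity θ I w.1 w.2 := by
  unfold particleDensity resampProb
  have hw : ∀ i : Fin N, Measurable fun w : State X Y E N × State X Y E N =>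
      S.weight θ (w.1.2.1 i) (w.2.2.1 i) w.1.1.2 := fun i =>
    (S.measurable_weight θ).comp (f := fun w : State X Y E N × State X Y E N =>
      (w.1.2.1 i, w.2.2.1 i, w.1.1.2)) (by fun_prop)
  refine (Finset.measurable_prod _ fun k _ => (S.q_meas θ).comp
    (f := fun w : State X Y E N × State X Y E N => (w.1.2.1 k, w.2.2.1 k, w.1.1.2))
    (by fun_prop)).mul (Finset.measurable_prod _ fun j _ => ?_)
  exact (hw (I j)).div (Finset.measurable_sum _ fun l _ => hw l)

lemma dataDensity_nonneg (z p : State X Y E N) : 0 ≤ S.dataDensity z p :=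
  mul_nonneg (S.mbar_nonneg _ _) (S.gbar_nonneg _ _)

lemma weight_nonneg (θ : EuclideanSpace ℝ (Fin d)) (x x' : X) (y : Y) : 0 ≤ S.weight θ x x' y :=
  div_nonneg (mul_nonneg (S.m_nonneg _ _ _) (S.g_nonneg _ _ _)) (S.q_nonneg _ _ _ _)

lemma resampProb_nonneg (θ : EuclideanSpace ℝ (Fin d)) (xt xp : Fin N → X) (y : Y) (i : Fin N) :
    0 ≤ S.resampProb θ xt xp y i :=
  div_nonneg (S.weight_nonneg _ _ _ _) (Finset.sum_nonneg fun _ _ => S.weight_nonneg _ _ _ _)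

lemma particleDensity_nonneg (θ : EuclideanSpace ℝ (Fin d)) (I : Fin N → Fin N)
    (z p : State X Y E N) : 0 ≤ S.particleDensity θ I z p :=
  mul_nonneg (Finset.prod_nonneg fun _ _ => S.q_nonneg _ _ _ _)
    (Finset.prod_nonneg fun _ _ => S.resampProb_nonneg _ _ _ _ _)

lemma lintegral_refMeasure_mul {f : X × Y → ENNReal} {g : (Fin N → X) → ENNReal}
    (hf : Measurable f) (hg : Measurable g) :
    ∫⁻ p, f p.1 * g p.2.1 ∂S.refMeasure N =
      (∫⁻ w, f w ∂S.mu.prod S.eta) * ∫⁻ x, g x ∂Measure.pi fun _ : Fin N => S.mu := by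
  rw [refMeasure, lintegral_prod_mul hf.aemeasurable (g := fun w : (Fin N → X) × (Fin N → E) =>
    g w.1) (hg.comp measurable_fst).aemeasurable]
  congr 1
  have := lintegral_prod_mul (μ := Measure.pi fun _ : Fin N => S.mu)
    (ν := Measure.pi fun _ : Fin N => S.nu) hg.aemeasurable (g := fun _ => 1) aemeasurable_const
  simpa using this

lemma lintegral_mbar_mul_gbar (x : X) :
    ∫⁻ w, ENNReal.ofReal (S.mbar x w.1 * S.gbar w.1 w.2) ∂S.mu.prod S.eta = 1 := by
  simp_rw [fun w : X × Y => ENNReal.ofReal_mul (q := S.gbar w.1 w.2) (S.mbar_nonneg x w.1)]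
  have hm : Measurable fun x' : X => ENNReal.ofReal (S.mbar x x') :=
    (S.mbar_meas.comp (f := fun x' => (x, x')) (by fun_prop)).ennreal_ofReal
  have hg := S.gbar_meas.ennreal_ofReal
  rw [lintegral_prod _ (by exact ((hm.comp measurable_fst).mul hg).aemeasurable)]
  have h : ∀ x', ∫⁻ y, ENNReal.ofReal (S.mbar x x') * ENNReal.ofReal (S.gbar x' y) ∂S.eta =
      ENNReal.ofReal (S.mbar x x') := fun x' => by
    have hy : Measurable fun y => ENNReal.ofReal (S.gbar x' y) := hg.comp measurable_prodMk_left
    rw [lintegral_const_mul _ hy, S.gbar_density, mul_one]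
  simp_rw [h, S.mbar_density]

lemma lintegral_gbar :
    ∫⁻ w, ENNReal.ofReal (S.gbar w.1 w.2) ∂S.mu.prod S.eta = S.mu Set.univ := by
  rw [lintegral_prod _ S.gbar_meas.ennreal_ofReal.aemeasurable]
  simp [S.gbar_density]

lemma lintegral_prod_q (θ : EuclideanSpace ℝ (Fin d)) (xt : Fin N → X) (y : Y) :
    ∫⁻ x, ENNReal.ofReal (∏ k, S.q θ (xt k) (x k) y) ∂Measure.pi (fun _ : Fin N => S.mu) = 1 := by
  have hm : ∀ k, Measurable fun x => S.q θ (xt k) x y := fun k =>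
    (S.q_meas θ).comp (f := fun x => (xt k, x, y)) (by fun_prop)
  have hi : ∀ k, Integrable (fun x => S.q θ (xt k) x y) S.mu := fun k => by
    refine ⟨(hm k).aestronglyMeasurable, ?_⟩
    rw [hasFiniteIntegral_iff_ofReal (ae_of_all _ fun x => S.q_nonneg _ _ _ _), S.q_density]
    exact ENNReal.one_lt_top
  rw [← ofReal_integral_eq_lintegral_ofReal (Integrable.fintype_prod hi)
    (ae_of_all _ fun x => Finset.prod_nonneg fun k _ => S.q_nonneg _ _ _ _),
    integral_fintype_prod_eq_prod (fun k x => S.q θ (xt k) x y)]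
  have h1 : ∀ k, ∫ x, S.q θ (xt k) x y ∂S.mu = 1 := fun k => by
    rw [integral_eq_lintegral_of_nonneg_ae (ae_of_all _ fun x => S.q_nonneg _ _ _ _)
      (hm k).aestronglyMeasurable, S.q_density, ENNReal.toReal_one]
  simp [h1]

/-- The data density does not involve the `N` new particles, which therefore contribute the factor
`mu(X) ^ N`; the noise has mass one. -/
lemma lintegral_dataDensity (z : State X Y E N) :
    ∫⁻ p, ENNReal.ofReal (S.dataDensity z p) ∂S.refMeasure N = S.mu Set.univ ^ N := by
  have hf : Measurable fun w : X × Y => ENNReal.ofReal (S.mbar z.1.1 w.1 * S.gbar w.1 w.2) :=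
    ((S.mbar_meas.comp (f := fun w : X × Y => (z.1.1, w.1)) (by fun_prop)).mul
      S.gbar_meas).ennreal_ofReal
  have := S.lintegral_refMeasure_mul (N := N) hf (g := fun _ => 1) measurable_const
  rw [S.lintegral_mbar_mul_gbar] at this
  simpa [Measure.pi_univ, dataDensity] using this

/-- Summing over all maps `I` a product over `j` is the product over `j` of sums, each equal to one.
-/
lemma sum_resampProb_prod (θ : EuclideanSpace ℝ (Fin d)) (xt xp : Fin N → X) (y : Y)
    (h : (∑ l, S.weight θ (xt l) (xp l) y) ≠ 0) :
    ∑ I : Fin N → Fin N, ∏ j, S.resampProb θ xt xp y (I j) = 1 := by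
  rw [← Fintype.prod_sum (fun (_ : Fin N) i => S.resampProb θ xt xp y i)]
  simp [resampProb, ← Finset.sum_div, div_self h]

end Densities

end Model

/-! ### Consequences of strong mixing: the Markov kernel and its minorization -/

/-- A constant bounding the weights and their Lipschitz constant. -/
noncomputable def weightConst (ε κ : ℝ) : ℝ :=
  2 * (2 * (1 / ε + κ) * (1 / ε + κ)) * (1 / ε + (1 / ε + κ) / ε ^ 2)

/-- A constant bounding the resampling probabilities and their Lipschitz constant. -/
noncomputable def resampConst (ε κ : ℝ) (N : ℕ) : ℝ :=
  2 * weightConst ε κ * (1 / ε ^ 3 + N * weightConst ε κ / (ε ^ 3) ^ 2)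

/-- A Lipschitz constant of the particle density. -/
noncomputable def densityConst (ε κ : ℝ) (N : ℕ) : ℝ :=
  2 * (2 * (1 / ε + κ)) ^ N * (2 * resampConst ε κ N) ^ N

/-- A Lipschitz constant of the transition law in total variation. -/
noncomputable def kernelConst (ε κ : ℝ) (N : ℕ) : ℝ :=
  Fintype.card (Fin N → Fin N) * (densityConst ε κ N * (1 / ε) ^ N)

/-- A lower bound of the density of the transition law with respect to the minorizing measure. -/
noncomputable def minorConst (ε : ℝ) (N : ℕ) : ℝ := ε ^ N * (ε ^ 6 / N) ^ N

namespace Model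

variable {X Y E : Type*} [MeasurableSpace X] [MeasurableSpace Y] [MeasurableSpace E] {d : ℕ}
  {S : Model X Y E d} {N : ℕ} {ε κ : ℝ}

namespace StrongMixing

lemma weight_mem (hs : S.StrongMixing ε) (hε₀ : 0 < ε) (θ : EuclideanSpace ℝ (Fin d)) (x x' : X)
    (y : Y) : ε ^ 3 ≤ S.weight θ x x' y ∧ S.weight θ x x' y ≤ 1 / ε ^ 3 := by
  obtain ⟨hm1, hm2⟩ := hs.m_mem θ x x'
  obtain ⟨hg1, hg2⟩ := hs.g_mem θ x' y
  obtain ⟨hq1, hq2⟩ := hs.q_mem θ x x' y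
  have hq0 := hε₀.trans_le hq1
  have hm0 := hε₀.trans_le hm1
  have hg0 := hε₀.trans_le hg1
  constructor
  · calc ε ^ 3 = ε * ε / (1 / ε) := by field_simp
      _ ≤ _ := by unfold weight; gcongr
  · calc S.weight θ x x' y ≤ (1 / ε) * (1 / ε) / ε := by unfold weight; gcongr
      _ = 1 / ε ^ 3 := by field_simp

lemma le_sum_weight (hs : S.StrongMixing ε) (hε₀ : 0 < ε) (hN : 0 < N)
    (θ : EuclideanSpace ℝ (Fin d)) (xt xp : Fin N → X) (y : Y) :
    ε ^ 3 ≤ ∑ l, S.weight θ (xt l) (xp l) y :=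
  (hs.weight_mem hε₀ θ (xt ⟨0, hN⟩) (xp ⟨0, hN⟩) y).1.trans
    (Finset.single_le_sum (f := fun l => S.weight θ (xt l) (xp l) y)
      (fun _ _ => S.weight_nonneg _ _ _ _) (Finset.mem_univ _))

/-- The numerator is at least `ε ^ 3` and each of the `N` weights in the denominator is at most `1 /
ε ^ 3`. -/
lemma le_resampProb (hs : S.StrongMixing ε) (hε₀ : 0 < ε) (hN : 0 < N)
    (θ : EuclideanSpace ℝ (Fin d)) (xt xp : Fin N → X) (y : Y) (i : Fin N) :
    ε ^ 6 / N ≤ S.resampProb θ xt xp y i := by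
  have h1 : ∑ l, S.weight θ (xt l) (xp l) y ≤ N * (1 / ε ^ 3) := by
    simpa using Finset.sum_le_card_nsmul Finset.univ _ _
      fun l _ => (hs.weight_mem hε₀ θ (xt l) (xp l) y).2
  have h2 : 0 < ∑ l, S.weight θ (xt l) (xp l) y :=
    (by positivity : (0 : ℝ) < ε ^ 3).trans_le (hs.le_sum_weight hε₀ hN θ xt xp y)
  have hN' : (0 : ℝ) < N := by exact_mod_cast hN
  calc ε ^ 6 / N = ε ^ 3 / (N * (1 / ε ^ 3)) := by field_simp
    _ ≤ _ := by
      unfold resampProb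
      have := (hs.weight_mem hε₀ θ (xt i) (xp i) y).1
      gcongr
      exact S.weight_nonneg _ _ _ _

lemma le_particleDensity (hs : S.StrongMixing ε) (hε₀ : 0 < ε) (hN : 0 < N)
    (θ : EuclideanSpace ℝ (Fin d)) (I : Fin N → Fin N) (z p : State X Y E N) :
    minorConst ε N ≤ S.particleDensity θ I z p := by
  have h1 : ε ^ N ≤ ∏ k, S.q θ (z.2.1 k) (p.2.1 k) z.1.2 := by
    simpa using Finset.prod_le_prod (s := Finset.univ) (f := fun _ : Fin N => ε)
      (fun _ _ => hε₀.le) fun k _ => (hs.q_mem θ (z.2.1 k) (p.2.1 k) z.1.2).1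
  have h2 : (ε ^ 6 / N) ^ N ≤ ∏ j, S.resampProb θ z.2.1 p.2.1 z.1.2 (I j) := by
    simpa only [Finset.prod_const, Finset.card_univ, Fintype.card_fin] using Finset.prod_le_prod (s := Finset.univ) (f := fun _ : Fin N => ε ^ 6 / N)
      (fun _ _ => by positivity) fun j _ => hs.le_resampProb hε₀ hN θ z.2.1 p.2.1 z.1.2 (I j)
  exact mul_le_mul h1 h2 (by positivity) (Finset.prod_nonneg fun _ _ => S.q_nonneg _ _ _ _)

/-- A probability density bounded below by `ε` forces `mu` to be finite. Any starting point would
do; `u` is at hand. -/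
lemma mu_univ_le (hs : S.StrongMixing ε) (hε₀ : 0 < ε) :
    S.mu Set.univ ≤ ENNReal.ofReal (1 / ε) := by
  have h := lintegral_mono (μ := S.mu) fun x' => ENNReal.ofReal_le_ofReal (hs.mbar_mem S.u x').1
  rw [S.mbar_density, lintegral_const] at h
  rw [one_div, ENNReal.ofReal_inv_of_pos hε₀]
  exact ENNReal.le_inv_iff_mul_le.2 (by rwa [mul_comm])

lemma le_mu_univ (hs : S.StrongMixing ε) (hε₀ : 0 < ε) :
    ENNReal.ofReal ε ≤ S.mu Set.univ := by
  have h := lintegral_mono (μ := S.mu) fun x' => ENNReal.ofReal_le_ofReal (hs.mbar_mem S.u x').2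
  rw [S.mbar_density, lintegral_const, one_div, ENNReal.ofReal_inv_of_pos hε₀] at h
  rw [← mul_one (ENNReal.ofReal ε)]
  refine (mul_le_mul_right h _).trans_eq ?_
  rw [← mul_assoc, ENNReal.mul_inv_cancel (by simpa using hε₀) ENNReal.ofReal_ne_top, one_mul]

lemma T_univ (hs : S.StrongMixing ε) (hε₀ : 0 < ε) (hN : 0 < N)
    (θ : EuclideanSpace ℝ (Fin d)) (z : State X Y E N) : S.T N θ z Set.univ = 1 := by
  rw [S.T_eq, Measure.finsetSum_apply]
  simp_rw [fun I : Fin N → Fin N => Measure.map_apply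
    (μ := (S.refMeasure N).withDensity fun p =>
      ENNReal.ofReal (S.dataDensity z p * S.particleDensity θ I z p))
    (measurable_resample (X := X) (Y := Y) (E := E) I) MeasurableSet.univ,
    Set.preimage_univ, withDensity_apply _ MeasurableSet.univ, Measure.restrict_univ]
  have hm : ∀ I : Fin N → Fin N, Measurable fun p : State X Y E N =>
      ENNReal.ofReal (S.dataDensity z p * S.particleDensity θ I z p) := fun I =>
    ((S.measurable_dataDensity.comp measurable_prodMk_left).mul
      ((S.measurable_particleDensity θ I).comp measurable_prodMk_left)).ennreal_ofReal
  rw [← lintegral_finsetSum _ fun I _ => hm I]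
  have h1 : ∀ p : State X Y E N, ∑ I : Fin N → Fin N,
      ENNReal.ofReal (S.dataDensity z p * S.particleDensity θ I z p) =
      ENNReal.ofReal (S.mbar z.1.1 p.1.1 * S.gbar p.1.1 p.1.2) *
        ENNReal.ofReal (∏ k, S.q θ (z.2.1 k) (p.2.1 k) z.1.2) := fun p => by
    rw [← ENNReal.ofReal_sum_of_nonneg fun I _ =>
      mul_nonneg (S.dataDensity_nonneg _ _) (S.particleDensity_nonneg _ _ _ _),
      ← Finset.mul_sum, ENNReal.ofReal_mul (S.dataDensity_nonneg z p), dataDensity]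
    congr 2
    simp_rw [particleDensity]
    rw [← Finset.mul_sum, S.sum_resampProb_prod, mul_one]
    exact ((by positivity : (0 : ℝ) < ε ^ 3).trans_le (hs.le_sum_weight hε₀ hN _ _ _ _)).ne'
  simp_rw [h1]
  have hf : Measurable fun w : X × Y => ENNReal.ofReal (S.mbar z.1.1 w.1 * S.gbar w.1 w.2) :=
    ((S.mbar_meas.comp (f := fun w : X × Y => (z.1.1, w.1)) (by fun_prop)).mul
      S.gbar_meas).ennreal_ofReal
  have hg : Measurable fun x : Fin N → X =>
      ENNReal.ofReal (∏ k, S.q θ (z.2.1 k) (x k) z.1.2) :=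
    (Finset.measurable_prod _ fun k _ => (S.q_meas θ).comp
      (f := fun x : Fin N → X => (z.2.1 k, x k, z.1.2)) (by fun_prop)).ennreal_ofReal
  rw [S.lintegral_refMeasure_mul hf hg, S.lintegral_mbar_mul_gbar, S.lintegral_prod_q, mul_one]

end StrongMixing

/-- `T_θ` as a kernel. -/
noncomputable def kernelT (S : Model X Y E d) (N : ℕ) (θ : EuclideanSpace ℝ (Fin d)) :
    Kernel (State X Y E N) (State X Y E N) where
  toFun := S.T N θ
  measurable' := by
    refine Measure.measurable_of_measurable_coe _ fun A hA => ?_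
    simp_rw [S.T_eq, Measure.finsetSum_apply, fun (I : Fin N → Fin N) z => Measure.map_apply
      (μ := (S.refMeasure N).withDensity fun p =>
        ENNReal.ofReal (S.dataDensity z p * S.particleDensity θ I z p))
      (measurable_resample (X := X) (Y := Y) (E := E) I) hA,
      fun (I : Fin N → Fin N) z => withDensity_apply
        (μ := S.refMeasure N) (fun p =>
        ENNReal.ofReal (S.dataDensity z p * S.particleDensity θ I z p))
        (measurable_resample (X := X) (Y := Y) (E := E) I hA)]
    refine Finset.measurable_sum _ fun I _ => ?_
    exact (S.measurable_dataDensity.mul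
      (S.measurable_particleDensity θ I)).ennreal_ofReal.lintegral_prod_right'

lemma kernelT_apply (S : Model X Y E d) (N : ℕ) (θ : EuclideanSpace ℝ (Fin d))
    (z : State X Y E N) : S.kernelT N θ z = S.T N θ z := rfl

/-- A measure, independent of the parameter and the state, below all transition laws. -/
noncomputable def minorMeasure (S : Model X Y E d) (N : ℕ) (ε : ℝ) : Measure (State X Y E N) :=
  ∑ I : Fin N → Fin N, ((S.refMeasure N).withDensity fun p =>
      ENNReal.ofReal (ε * S.gbar p.1.1 p.1.2 * minorConst ε N)).map (resample I)

namespace StrongMixing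

lemma isMarkovKernel (hs : S.StrongMixing ε) (hε₀ : 0 < ε) (hN : 0 < N)
    (θ : EuclideanSpace ℝ (Fin d)) : IsMarkovKernel (S.kernelT N θ) :=
  ⟨fun z => ⟨hs.T_univ hε₀ hN θ z⟩⟩

/-- Only `mbar` and the particle density are replaced by lower bounds. The emission density `gbar`
is kept: it has no lower bound, but it depends on neither `z` nor `θ`. -/
lemma minorMeasure_le (hs : S.StrongMixing ε) (hε₀ : 0 < ε) (hN : 0 < N)
    (θ : EuclideanSpace ℝ (Fin d)) (z : State X Y E N) :
    S.minorMeasure N ε ≤ S.kernelT N θ z := by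
  rw [kernelT_apply, S.T_eq, minorMeasure]
  refine Finset.sum_le_sum fun I _ => Measure.map_mono (withDensity_mono (ae_of_all _ fun p => ?_))
    (measurable_resample I)
  refine ENNReal.ofReal_le_ofReal (mul_le_mul ?_ (hs.le_particleDensity hε₀ hN θ I z p) ?_
    (S.dataDensity_nonneg _ _))
  · exact mul_le_mul_of_nonneg_right (hs.mbar_mem _ _).1 (S.gbar_nonneg _ _)
  · unfold minorConst
    positivity

lemma isFiniteMeasure_minorMeasure (hs : S.StrongMixing ε) (hε₀ : 0 < ε) (hN : 0 < N) :
    IsFiniteMeasure (S.minorMeasure N ε) := by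
  obtain ⟨z⟩ := S.nonempty_state N
  have := hs.isMarkovKernel hε₀ hN 0
  exact isFiniteMeasure_of_le _ (hs.minorMeasure_le hε₀ hN 0 z)

lemma le_minorMeasure_univ (hs : S.StrongMixing ε) (hε₀ : 0 < ε) (hN : 0 < N) :
    ENNReal.ofReal (ε * minorConst ε N * ε ^ (N + 1)) ≤ S.minorMeasure N ε Set.univ := by
  rw [minorMeasure, Measure.finsetSum_apply]
  -- The single ancestor map `I = id` already gives the lower bound. Integrating `gbar` over `y`
  -- leaves `mu(X)` for the data point and `mu(X) ^ N` for the particles, whence `ε ^ (N + 1)`.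
  refine le_trans ?_ (Finset.single_le_sum (fun _ _ => zero_le) (Finset.mem_univ id))
  rw [Measure.map_apply (measurable_resample _) MeasurableSet.univ, Set.preimage_univ,
    withDensity_apply _ MeasurableSet.univ, Measure.restrict_univ]
  have hc : 0 ≤ ε * minorConst ε N := by unfold minorConst; positivity
  have h1 : ∀ p : State X Y E N, ENNReal.ofReal (ε * S.gbar p.1.1 p.1.2 * minorConst ε N) =
      ENNReal.ofReal (ε * minorConst ε N) * (ENNReal.ofReal (S.gbar p.1.1 p.1.2) * 1) := fun p => by
    rw [mul_one, ← ENNReal.ofReal_mul hc, mul_right_comm]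
  simp_rw [h1]
  have hm : Measurable fun p : State X Y E N => ENNReal.ofReal (S.gbar p.1.1 p.1.2) * 1 :=
    ((S.gbar_meas.comp measurable_fst).ennreal_ofReal).mul_const _
  rw [lintegral_const_mul _ hm, S.lintegral_refMeasure_mul (N := N) S.gbar_meas.ennreal_ofReal
    (g := fun _ => 1) measurable_const, S.lintegral_gbar, lintegral_one, Measure.pi_univ,
    ENNReal.ofReal_mul hc, ENNReal.ofReal_pow hε₀.le, pow_succ']
  have := hs.le_mu_univ hε₀
  simp only [Finset.prod_const, Finset.card_univ, Fintype.card_fin]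
  gcongr

end StrongMixing

end Model

/-! ### Lipschitz dependence of the transition law on the parameter -/

namespace Model

variable {X Y E : Type*} [MeasurableSpace X] [MeasurableSpace Y] [MeasurableSpace E] {d : ℕ}
  {S : Model X Y E d} {N : ℕ} {ε κ : ℝ}

lemma boundedLip_of_mem_Icc {F : Type*} [SeminormedAddCommGroup F] {f : F → ℝ} (hε₀ : 0 < ε)
    (hκ : 0 ≤ κ) (hf : ∀ θ, ε ≤ f θ ∧ f θ ≤ 1 / ε)
    (hl : ∀ θ θ', |f θ - f θ'| ≤ κ * ‖θ - θ'‖) : BoundedLip f (1 / ε + κ) := by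
  have h0 : 0 ≤ 1 / ε := by positivity
  refine ⟨fun θ => ?_, fun θ θ' => (hl θ θ').trans ?_⟩
  · rw [Real.norm_eq_abs, abs_of_pos (hε₀.trans_le (hf θ).1)]
    linarith [(hf θ).2]
  · gcongr
    linarith

namespace StrongMixing

variable (hs : S.StrongMixing ε) (hl : S.LipschitzGradients κ) (hε₀ : 0 < ε) (hκ : 0 ≤ κ)

include hs hl hε₀ hκ

lemma boundedLip_weight (x x' : X) (y : Y) :
    BoundedLip (fun θ => S.weight θ x x' y) (weightConst ε κ) := by
  unfold weight weightConst
  simp_rw [div_eq_mul_inv (_ * _)]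
  exact ((boundedLip_of_mem_Icc hε₀ hκ (fun θ => hs.m_mem θ x x') (hl.m_lip x x')).mul
    (boundedLip_of_mem_Icc hε₀ hκ (fun θ => hs.g_mem θ x' y) (hl.g_lip x' y))).mul
    ((boundedLip_of_mem_Icc hε₀ hκ (fun θ => hs.q_mem θ x x' y) (hl.q_lip x x' y)).inv hε₀
      fun θ => (hs.q_mem θ x x' y).1)

lemma boundedLip_resampProb (hN : 0 < N) (xt xp : Fin N → X) (y : Y) (i : Fin N) :
    BoundedLip (fun θ => S.resampProb θ xt xp y i) (resampConst ε κ N) := by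
  unfold resampProb resampConst
  simp_rw [div_eq_mul_inv (S.weight _ _ _ _)]
  have h := BoundedLip.sum Finset.univ
    fun l _ => hs.boundedLip_weight hl hε₀ hκ (xt l) (xp l) y
  rw [Finset.card_univ, Fintype.card_fin] at h
  exact (hs.boundedLip_weight hl hε₀ hκ _ _ _).mul
    (h.inv (by positivity) fun θ => hs.le_sum_weight hε₀ hN θ xt xp y)

lemma boundedLip_particleDensity (hN : 0 < N) (I : Fin N → Fin N) (z p : State X Y E N) :
    BoundedLip (fun θ => S.particleDensity θ I z p) (densityConst ε κ N) := by
  unfold particleDensity densityConst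
  have h1 := BoundedLip.prod Finset.univ fun k _ =>
    boundedLip_of_mem_Icc hε₀ hκ (fun θ => hs.q_mem θ (z.2.1 k) (p.2.1 k) z.1.2)
      (hl.q_lip (z.2.1 k) (p.2.1 k) z.1.2)
  have h2 := BoundedLip.prod Finset.univ fun j _ =>
    hs.boundedLip_resampProb hl hε₀ hκ hN z.2.1 p.2.1 z.1.2 (I j)
  rw [Finset.card_univ, Fintype.card_fin] at h1 h2
  exact h1.mul h2

end StrongMixing

namespace StrongMixing

variable (hs : S.StrongMixing ε) (hl : S.LipschitzGradients κ) (hε₀ : 0 < ε) (hκ : 0 ≤ κ)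

include hs hε₀

lemma integrable_dataDensity (z : State X Y E N) :
    Integrable (S.dataDensity z) (S.refMeasure N) ∧
      ∫ p, S.dataDensity z p ∂S.refMeasure N ≤ (1 / ε) ^ N := by
  have hm : Measurable (S.dataDensity z) := S.measurable_dataDensity.comp measurable_prodMk_left
  have h0 : 0 ≤ᵐ[S.refMeasure N] S.dataDensity z := ae_of_all _ (S.dataDensity_nonneg z)
  have h1 : S.mu Set.univ ^ N ≤ ENNReal.ofReal ((1 / ε) ^ N) := by
    rw [ENNReal.ofReal_pow (by positivity)]
    gcongr
    exact hs.mu_univ_le hε₀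
  refine ⟨⟨hm.aestronglyMeasurable, ?_⟩, ?_⟩
  · rw [hasFiniteIntegral_iff_ofReal h0, S.lintegral_dataDensity]
    exact h1.trans_lt ENNReal.ofReal_lt_top
  · rw [integral_eq_lintegral_of_nonneg_ae h0 hm.aestronglyMeasurable, S.lintegral_dataDensity]
    exact ENNReal.toReal_le_of_le_ofReal (by positivity) h1

/-- All laws `T_θ(z, ·)` are written over the common reference measure, so that two parameters can
be compared through their densities. -/
lemma integral_T {F : Type*} [NormedAddCommGroup F] [NormedSpace ℝ F] (hN : 0 < N)
    (θ : EuclideanSpace ℝ (Fin d)) (z : State X Y E N)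
    {f : State X Y E N → F} {C : ℝ} (hf : StronglyMeasurable f) (hC : ∀ z, ‖f z‖ ≤ C) :
    ∫ z', f z' ∂S.T N θ z = ∑ I : Fin N → Fin N,
      ∫ p, (S.dataDensity z p * S.particleDensity θ I z p) • f (resample I p) ∂S.refMeasure N := by
  have hmark := hs.isMarkovKernel hε₀ hN θ
  -- Each summand lies below a probability measure, hence is finite and integrates bounded
  -- functions.
  have hle : ∀ I : Fin N → Fin N, ((S.refMeasure N).withDensity fun p =>
      ENNReal.ofReal (S.dataDensity z p * S.particleDensity θ I z p)).map (resample I) ≤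
      S.kernelT N θ z := fun I => by
    rw [kernelT_apply, S.T_eq]
    exact Finset.single_le_sum (f := fun I : Fin N → Fin N =>
      ((S.refMeasure N).withDensity fun p =>
      ENNReal.ofReal (S.dataDensity z p * S.particleDensity θ I z p)).map (resample I))
      (fun _ _ => Measure.zero_le _) (Finset.mem_univ I)
  rw [S.T_eq, integral_finsetSum_measure]
  · refine Finset.sum_congr rfl fun I _ => ?_
    have hm1 : Measurable (S.dataDensity z) := S.measurable_dataDensity.comp measurable_prodMk_left
    have hm2 : Measurable (S.particleDensity θ I z) :=
      (S.measurable_particleDensity θ I).comp measurable_prodMk_left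
    rw [integral_map (measurable_resample I).aemeasurable hf.aestronglyMeasurable,
      integral_withDensity_eq_integral_toReal_smul (by exact (hm1.mul hm2).ennreal_ofReal)
        (ae_of_all _ fun _ => ENNReal.ofReal_lt_top)]
    refine integral_congr_ae (ae_of_all _ fun p => ?_)
    simp only
    rw [ENNReal.toReal_ofReal
      (mul_nonneg (S.dataDensity_nonneg _ _) (S.particleDensity_nonneg _ _ _ _))]
  · intro I _
    have := isFiniteMeasure_of_le _ (hle I)
    exact integrable_of_bound hf hC

include hl hκ

lemma integrable_density_smul {F : Type*} [NormedAddCommGroup F] [NormedSpace ℝ F] (hN : 0 < N)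
    (θ : EuclideanSpace ℝ (Fin d)) (z : State X Y E N) (I : Fin N → Fin N)
    {f : State X Y E N → F} {C : ℝ} (hf : StronglyMeasurable f) (hC : ∀ z, ‖f z‖ ≤ C) :
    Integrable (fun p => (S.dataDensity z p * S.particleDensity θ I z p) • f (resample I p))
      (S.refMeasure N) := by
  have hm1 : Measurable (S.dataDensity z) := S.measurable_dataDensity.comp measurable_prodMk_left
  have hm2 : Measurable (S.particleDensity θ I z) :=
    (S.measurable_particleDensity θ I).comp measurable_prodMk_left
  refine Integrable.mono' ((hs.integrable_dataDensity hε₀ z).1.mul_const (densityConst ε κ N * C))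
    ((hm1.mul hm2).stronglyMeasurable.smul
      (hf.comp_measurable (measurable_resample I))).aestronglyMeasurable (ae_of_all _ fun p => ?_)
  have h := hs.boundedLip_particleDensity hl hε₀ hκ hN I z p
  rw [norm_smul, norm_mul, Real.norm_of_nonneg (S.dataDensity_nonneg z p), Real.norm_eq_abs,
    mul_assoc]
  have h0 := S.dataDensity_nonneg z p
  have := h.nonneg
  gcongr
  exacts [h.bound θ, hC _]

/-- The transition law is Lipschitz in the parameter, in total variation. -/
lemma norm_integral_T_sub_le {F : Type*} [NormedAddCommGroup F] [NormedSpace ℝ F] (hN : 0 < N)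
    (θ θ' : EuclideanSpace ℝ (Fin d)) (z : State X Y E N)
    {f : State X Y E N → F} {C : ℝ} (hf : StronglyMeasurable f) (hC : ∀ z, ‖f z‖ ≤ C) :
    ‖∫ z', f z' ∂S.T N θ z - ∫ z', f z' ∂S.T N θ' z‖ ≤ kernelConst ε κ N * C * ‖θ - θ'‖ := by
  have hC0 : 0 ≤ C := (norm_nonneg _).trans (hC z)
  rw [hs.integral_T hε₀ hN θ z hf hC, hs.integral_T hε₀ hN θ' z hf hC,
    ← Finset.sum_sub_distrib]
  have h1 : ∀ I : Fin N → Fin N,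
      ‖∫ p, (S.dataDensity z p * S.particleDensity θ I z p) • f (resample I p) ∂S.refMeasure N -
      ∫ p, (S.dataDensity z p * S.particleDensity θ' I z p) • f (resample I p) ∂S.refMeasure N‖ ≤
      (densityConst ε κ N * (1 / ε) ^ N) * C * ‖θ - θ'‖ := fun I => by
    obtain ⟨hi, hle⟩ := hs.integrable_dataDensity hε₀ z
    rw [← integral_sub (hs.integrable_density_smul hl hε₀ hκ hN θ z I hf hC)
      (hs.integrable_density_smul hl hε₀ hκ hN θ' z I hf hC)]
    refine (norm_integral_le_of_norm_le
      (hi.mul_const (densityConst ε κ N * C * ‖θ - θ'‖)) (ae_of_all _ fun p => ?_)).trans ?_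
    · have h := hs.boundedLip_particleDensity hl hε₀ hκ hN I z p
      have h0 := S.dataDensity_nonneg z p
      rw [← sub_smul, ← mul_sub, norm_smul, norm_mul, Real.norm_of_nonneg h0, Real.norm_eq_abs,
        mul_assoc]
      refine mul_le_mul_of_nonneg_left ?_ h0
      calc _ ≤ densityConst ε κ N * ‖θ - θ'‖ * C := by
            have := h.nonneg
            gcongr
            exacts [h.lip θ θ', hC _]
        _ = _ := by ring
    · have h := (hs.boundedLip_particleDensity hl hε₀ hκ hN I z z).nonneg
      rw [integral_mul_const]
      calc _ ≤ (1 / ε) ^ N * (densityConst ε κ N * C * ‖θ - θ'‖) := by gcongr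
        _ = _ := by ring
  refine (norm_sum_le_of_le _ fun I _ => h1 I).trans_eq ?_
  rw [Finset.sum_const, Finset.card_univ, nsmul_eq_mul, kernelConst]
  ring

end StrongMixing

end Model

/-! ### The gradient of the logarithm of the total weight -/

/-- A constant bounding the inverse proposal density, its gradient and their Lipschitz constants. -/
noncomputable def invConst (ε κ : ℝ) : ℝ :=
  1 / ε + (1 / ε + κ) / ε ^ 2 +
    2 * (2 * (1 / ε + (1 / ε + κ) / ε ^ 2) * (1 / ε + (1 / ε + κ) / ε ^ 2)) * (1 / ε + κ)

/-- A constant bounding the total weight, its gradient and their Lipschitz constants. -/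
noncomputable def totalWeightConst (ε κ : ℝ) (N : ℕ) : ℝ :=
  N * (4 * (4 * (1 / ε + κ) * (1 / ε + κ)) * invConst ε κ)

/-- A constant bounding the gradient of the log-weight and its Lipschitz constant. -/
noncomputable def gradConst (ε κ : ℝ) (N : ℕ) : ℝ :=
  2 * (1 / ε ^ 3 + totalWeightConst ε κ N / (ε ^ 3) ^ 2) * totalWeightConst ε κ N

section Gradient

variable {d : ℕ} {ε κ : ℝ}

lemma gradient_eq_toDual_symm (f : EuclideanSpace ℝ (Fin d) → ℝ) (θ : EuclideanSpace ℝ (Fin d)) :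
    gradient f θ = (InnerProductSpace.toDual ℝ _).symm (fderiv ℝ f θ) := rfl

lemma norm_gradient_sub (f : EuclideanSpace ℝ (Fin d) → ℝ) (θ θ' : EuclideanSpace ℝ (Fin d)) :
    ‖gradient f θ - gradient f θ'‖ = ‖fderiv ℝ f θ - fderiv ℝ f θ'‖ := by
  rw [gradient_eq_toDual_symm, gradient_eq_toDual_symm, ← map_sub, LinearIsometryEquiv.norm_map]

lemma norm_gradient (f : EuclideanSpace ℝ (Fin d) → ℝ) (θ : EuclideanSpace ℝ (Fin d)) :
    ‖gradient f θ‖ = ‖fderiv ℝ f θ‖ := by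
  rw [gradient_eq_toDual_symm, LinearIsometryEquiv.norm_map]

lemma BoundedLip.gradient {f : EuclideanSpace ℝ (Fin d) → ℝ} {A : ℝ}
    (h : BoundedLip (fderiv ℝ f) A) : BoundedLip (gradient f) A :=
  ⟨fun θ => (norm_gradient f θ).trans_le (h.bound θ),
    fun θ θ' => (norm_gradient_sub f θ θ').trans_le (h.lip θ θ')⟩

lemma measurable_gradient_apply {Z : Type*} [MeasurableSpace Z]
    {f : Z → EuclideanSpace ℝ (Fin d) → ℝ} (hf : ∀ z, Differentiable ℝ (f z))
    (hm : ∀ θ, Measurable fun z => f z θ) (θ : EuclideanSpace ℝ (Fin d)) :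
    Measurable fun z => _root_.gradient (f z) θ := by
  have h1 : ∀ v : EuclideanSpace ℝ (Fin d), Measurable fun z => fderiv ℝ (f z) θ v := fun v => by
    -- The directional derivative is the limit of the difference quotients with increments `v / n`,
    -- each measurable in `z`.
    refine measurable_of_tendsto_metrizable
      (f := fun (n : ℕ) z => (n : ℝ) • (f z (θ + (n : ℝ)⁻¹ • v) - f z θ))
      (fun n => ((hm _).sub (hm _)).const_mul _) (tendsto_pi_nhds.2 fun z => ?_)
    exact ((hf z θ).hasFDerivAt.lim_real v).comp tendsto_natCast_atTop_atTop
  have h2 : ∀ z, _root_.gradient (f z) θ = ∑ i, fderiv ℝ (f z) θ (EuclideanSpace.basisFun _ ℝ i) •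
      EuclideanSpace.basisFun (Fin d) ℝ i := fun z => by
    conv_lhs => rw [← (EuclideanSpace.basisFun (Fin d) ℝ).sum_repr' (_root_.gradient (f z) θ)]
    refine Finset.sum_congr rfl fun i _ => ?_
    rw [real_inner_comm, gradient_eq_toDual_symm, InnerProductSpace.toDual_symm_apply]
  simp_rw [h2]
  exact Finset.measurable_sum _ fun i _ => (h1 _).smul_const _

lemma smoothBound_of_gradient {f : EuclideanSpace ℝ (Fin d) → ℝ}
    (hε₀ : 0 < ε) (hκ : 0 ≤ κ) (hd : Differentiable ℝ f)
    (hf : ∀ θ, ε ≤ f θ ∧ f θ ≤ 1 / ε) (hlip : ∀ θ θ', |f θ - f θ'| ≤ κ * ‖θ - θ'‖)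
    (hg : ∀ θ, ‖gradient f θ‖ ≤ κ)
    (hgl : ∀ θ θ', ‖gradient f θ - gradient f θ'‖ ≤ κ * ‖θ - θ'‖) :
    SmoothBound f (1 / ε + κ) :=
  ⟨hd, Model.boundedLip_of_mem_Icc hε₀ hκ hf hlip, BoundedLip.mono
    ⟨fun θ => (norm_gradient f θ).symm.trans_le (hg θ),
      fun θ θ' => (norm_gradient_sub f θ θ').symm.trans_le (hgl θ θ')⟩
    (le_add_of_nonneg_left (by positivity))⟩

end Gradient

namespace Model

variable {X Y E : Type*} [MeasurableSpace X] [MeasurableSpace Y] [MeasurableSpace E] {d : ℕ}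
  {S : Model X Y E d} {N : ℕ} {ε κ : ℝ}

/-- The total weight of the reparameterized particles. -/
noncomputable def totalWeight (S : Model X Y E d) (z : State X Y E N)
    (θ : EuclideanSpace ℝ (Fin d)) : ℝ :=
  ∑ i, S.weight θ (z.2.1 i) (S.R θ (z.2.1 i) z.1.2 (z.2.2 i)) z.1.2

lemma measurable_totalWeight (θ : EuclideanSpace ℝ (Fin d)) :
    Measurable fun z : State X Y E N => S.totalWeight z θ := by
  refine Finset.measurable_sum _ fun i _ => (S.measurable_weight θ).comp
    (f := fun z : State X Y E N => (z.2.1 i, S.R θ (z.2.1 i) z.1.2 (z.2.2 i), z.1.2)) ?_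
  have : Measurable fun z : State X Y E N => S.R θ (z.2.1 i) z.1.2 (z.2.2 i) :=
    (S.R_meas θ).comp (f := fun z : State X Y E N => (z.2.1 i, z.1.2, z.2.2 i)) (by fun_prop)
  fun_prop

namespace StrongMixing

variable (hs : S.StrongMixing ε) (hl : S.LipschitzGradients κ) (hε₀ : 0 < ε) (hκ : 0 ≤ κ)

include hs hε₀

lemma le_totalWeight (hN : 0 < N) (z : State X Y E N) (θ : EuclideanSpace ℝ (Fin d)) :
    ε ^ 3 ≤ S.totalWeight z θ :=
  hs.le_sum_weight hε₀ hN θ z.2.1 (fun i => S.R θ (z.2.1 i) z.1.2 (z.2.2 i)) z.1.2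

include hl hκ

/-- Here `θ` also moves the particle `R_θ`, so the hypotheses on the composed functions enter; the
transition law used the Lipschitz bounds at fixed arguments. -/
lemma smoothBound_totalWeight (z : State X Y E N) :
    SmoothBound (S.totalWeight z) (totalWeightConst ε κ N) := by
  have h := SmoothBound.sum Finset.univ (f := fun (i : Fin N) θ =>
      S.weight θ (z.2.1 i) (S.R θ (z.2.1 i) z.1.2 (z.2.2 i)) z.1.2)
    (A := 4 * (4 * (1 / ε + κ) * (1 / ε + κ)) * invConst ε κ) fun i _ => by
      simp_rw [weight, div_eq_mul_inv (_ * _)]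
      have h1 := smoothBound_of_gradient hε₀ hκ (hl.mR_diff (z.2.1 i) z.1.2 (z.2.2 i))
        (fun θ => hs.m_mem _ _ _) (hl.mR_lip _ _ _) (hl.mR_grad_le _ _ _) (hl.mR_grad_lip _ _ _)
      have h2 := smoothBound_of_gradient hε₀ hκ (hl.gR_diff (z.2.1 i) z.1.2 (z.2.2 i))
        (fun θ => hs.g_mem _ _ _) (hl.gR_lip _ _ _) (hl.gR_grad_le _ _ _) (hl.gR_grad_lip _ _ _)
      have h3 := smoothBound_of_gradient hε₀ hκ (hl.qR_diff (z.2.1 i) z.1.2 (z.2.2 i))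
        (fun θ => hs.q_mem _ _ _ _) (hl.qR_lip _ _ _) (hl.qR_grad_le _ _ _) (hl.qR_grad_lip _ _ _)
      exact (h1.mul h2).mul (h3.inv hε₀ fun θ => (hs.q_mem _ _ _ _).1)
  rw [Finset.card_univ, Fintype.card_fin] at h
  exact h

lemma boundedLip_H (hN : 0 < N) (z : State X Y E N) :
    BoundedLip (fun θ => S.H N θ z) (gradConst ε κ N) :=
  ((hs.smoothBound_totalWeight hl hε₀ hκ z).boundedLip_fderiv_log (by positivity)
    fun θ => hs.le_totalWeight hε₀ hN z θ).gradient

lemma measurable_H (hN : 0 < N) (θ : EuclideanSpace ℝ (Fin d)) : Measurable (S.H N θ) := by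
  refine measurable_gradient_apply (f := fun (z : State X Y E N) ϑ =>
    Real.log (S.totalWeight z ϑ)) (fun z => ?_)
    (fun θ => (measurable_totalWeight θ).log) θ
  exact (hs.smoothBound_totalWeight hl hε₀ hκ z).diff.log fun ϑ =>
    ((by positivity : (0 : ℝ) < ε ^ 3).trans_le (hs.le_totalWeight hε₀ hN z ϑ)).ne'

end StrongMixing

end Model

/-! ### Regularity of the Poisson solutions -/

/-- A lower bound of the mass of the minorizing measure. -/
noncomputable def minorMass (ε : ℝ) (N : ℕ) : ℝ := ε * minorConst ε N * ε ^ (N + 1)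

/-- A bound on the Poisson solution. -/
noncomputable def solConst (ε κ : ℝ) (N : ℕ) : ℝ := gradConst ε κ N / minorMass ε N

/-- A Lipschitz constant of the Poisson solution. -/
noncomputable def solLipConst (ε κ : ℝ) (N : ℕ) : ℝ :=
  (gradConst ε κ N + kernelConst ε κ N * solConst ε κ N) / minorMass ε N

/-- A constant for the regularity of the Poisson solutions. -/
noncomputable def poissonConst (ε κ : ℝ) (N : ℕ) : ℝ :=
  1 + gradConst ε κ N + solConst ε κ N + solLipConst ε κ N + kernelConst ε κ N * solConst ε κ N

lemma minorMass_pos {ε : ℝ} {N : ℕ} (hε₀ : 0 < ε) (hN : 0 < N) : 0 < minorMass ε N := by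
  unfold minorMass minorConst
  positivity

lemma gradConst_nonneg {ε κ : ℝ} {N : ℕ} (hε₀ : 0 < ε) (hκ : 0 ≤ κ) : 0 ≤ gradConst ε κ N := by
  unfold gradConst totalWeightConst invConst
  positivity

lemma kernelConst_nonneg {ε κ : ℝ} {N : ℕ} (hε₀ : 0 < ε) (hκ : 0 ≤ κ) :
    0 ≤ kernelConst ε κ N := by
  unfold kernelConst densityConst resampConst weightConst
  positivity

namespace Model

variable {X Y E : Type*} [MeasurableSpace X] [MeasurableSpace Y] [MeasurableSpace E] {d : ℕ}
  {S : Model X Y E d} {N : ℕ} {ε κ : ℝ}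

namespace StrongMixing

variable (hs : S.StrongMixing ε) (hε₀ : 0 < ε) (hN : 0 < N)

include hs hε₀ hN

lemma minorMass_le : minorMass ε N ≤ (S.minorMeasure N ε).real Set.univ := by
  have := hs.isFiniteMeasure_minorMeasure hε₀ hN
  exact (ENNReal.ofReal_le_iff_le_toReal (measure_ne_top _ _)).1 (hs.le_minorMeasure_univ hε₀ hN)

lemma minorMeasure_univ_ne_zero : S.minorMeasure N ε Set.univ ≠ 0 := by
  intro h
  have h1 := hs.minorMass_le hε₀ hN
  rw [measureReal_def, h, ENNReal.toReal_zero] at h1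
  exact h1.not_gt (minorMass_pos hε₀ hN)

lemma minorMeasure_real_le_one : (S.minorMeasure N ε).real Set.univ ≤ 1 := by
  obtain ⟨z⟩ := S.nonempty_state N
  have := hs.isMarkovKernel hε₀ hN 0
  exact ENNReal.toReal_le_of_le_ofReal zero_le_one
    ((hs.minorMeasure_le hε₀ hN 0 z Set.univ).trans (by simp))

/-- The extended chain has a unique stationary distribution. -/
lemma existsUnique_isStationary (θ : EuclideanSpace ℝ (Fin d)) :
    ∃! π, S.IsStationary N θ π := by
  have := hs.isMarkovKernel hε₀ hN θ
  have := hs.isFiniteMeasure_minorMeasure hε₀ hN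
  have h0 := hs.minorMeasure_univ_ne_zero hε₀ hN
  obtain ⟨π, hπ, hinv⟩ := exists_invariant_of_minorized (S.kernelT N θ) _
    (hs.minorMeasure_le hε₀ hN θ) h0
  refine ⟨π, ⟨hπ, hinv⟩, fun π' h' => ?_⟩
  have := h'.prob
  exact invariant_unique_of_minorized (hs.minorMeasure_le hε₀ hN θ) h0 h'.invariant hinv

lemma isStationary_stat (θ : EuclideanSpace ℝ (Fin d)) : S.IsStationary N θ (S.stat N θ) := by
  have h := (hs.existsUnique_isStationary hε₀ hN θ).exists
  rw [stat, dif_pos h]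
  exact h.choose_spec

variable (hl : S.LipschitzGradients κ) (hκ : 0 ≤ κ)

include hl hκ

lemma integrable_H_stat (θ : EuclideanSpace ℝ (Fin d)) :
    Integrable (S.H N θ) (S.stat N θ) := by
  have := (hs.isStationary_stat hε₀ hN θ).prob
  exact integrable_of_bound (hs.measurable_H hl hε₀ hκ hN θ).stronglyMeasurable
    fun z => (hs.boundedLip_H hl hε₀ hκ hN z).bound θ

/-- The constant depends on the model only through `d`, `N`, `ε` and `κ`. -/
theorem isPoissonConstant : S.IsPoissonConstant N (poissonConst ε κ N) := by
  have hmark := hs.isMarkovKernel hε₀ hN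
  have hfin := hs.isFiniteMeasure_minorMeasure hε₀ hN
  have h0 := hs.minorMeasure_univ_ne_zero hε₀ hN
  have hb := hs.minorMeasure_le hε₀ hN
  have hH := fun z => hs.boundedLip_H hl hε₀ hκ hN z
  have hHm := fun θ => (hs.measurable_H hl hε₀ hκ hN θ).stronglyMeasurable
  have hδ := minorMass_pos hε₀ hN
  have hδle := hs.minorMass_le hε₀ hN
  have hδ1 := hs.minorMeasure_real_le_one hε₀ hN
  have hG : 0 ≤ gradConst ε κ N := gradConst_nonneg hε₀ hκ
  have hK : 0 ≤ kernelConst ε κ N := kernelConst_nonneg hε₀ hκ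
  have hU : 0 ≤ solConst ε κ N := div_nonneg hG hδ.le
  have hW : 0 ≤ solLipConst ε κ N := div_nonneg (by positivity) hδ.le
  have hKU := mul_nonneg hK hU
  set b := S.minorMeasure N ε
  let u := fun θ => poissonSol (S.kernelT N θ) b (hb θ) (S.H N θ)
  have hum : ∀ θ, StronglyMeasurable (u θ) := fun θ => stronglyMeasurable_poissonSol h0 (hHm θ)
  have hub : ∀ θ z, ‖u θ z‖ ≤ solConst ε κ N := fun θ z =>
    (norm_poissonSol_le h0 (fun z => (hH z).bound θ) z).trans
      (div_le_div_of_nonneg_left hG hδ hδle)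
  -- Since `b` is the same for all `θ`, Lipschitz continuity of `u` will give that of the mean
  -- field, with no comparison of stationary laws.
  have hmf : ∀ θ, S.meanField N θ = ∫ z, u θ z ∂b := fun θ => by
    have hst := hs.isStationary_stat hε₀ hN θ
    have := hst.prob
    exact integral_eq_of_invariant h0 (hHm θ) (fun z => (hH z).bound θ) hst.invariant
  have hueq : ∀ θ z, u θ z = S.H N θ z + ∫ z', u θ z' ∂S.T N θ z - ∫ z', u θ z' ∂b := fun θ z =>
    poissonSol_eq h0 (hHm θ) (fun z => (hH z).bound θ) z
  have hTb : ∀ θ z {f : State X Y E N → EuclideanSpace ℝ (Fin d)} {C : ℝ}, (∀ z, ‖f z‖ ≤ C) →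
      ‖∫ z', f z' ∂S.T N θ z‖ ≤ C := fun θ z f C hC =>
    (norm_integral_le_mul (μ := S.kernelT N θ z) hC).trans_eq (by simp)
  have hTint : ∀ θ θ' z, Integrable (u θ') (S.T N θ z) := fun θ θ' z =>
    integrable_of_bound (μ := S.kernelT N θ z) (hum θ') (hub θ')
  have hsub : ∀ θ θ' z, ∫ z', u θ z' ∂S.T N θ z - ∫ z', u θ' z' ∂S.T N θ' z =
      ∫ z', (u θ z' - u θ' z') ∂S.T N θ z +
        (∫ z', u θ' z' ∂S.T N θ z - ∫ z', u θ' z' ∂S.T N θ' z) := fun θ θ' z => by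
    rw [integral_sub (hTint _ _ _) (hTint _ _ _)]
    abel
  have hTlip : ∀ θ θ' z, ‖∫ z', u θ' z' ∂S.T N θ z - ∫ z', u θ' z' ∂S.T N θ' z‖ ≤
      kernelConst ε κ N * solConst ε κ N * ‖θ - θ'‖ := fun θ θ' z =>
    hs.norm_integral_T_sub_le hl hε₀ hκ hN θ θ' z (hum θ') (hub θ')
  -- The term `T_θ u_θ - T_θ' u_θ'` is split as `T_θ (u_θ - u_θ') + (T_θ - T_θ') u_θ'`. Subtracting
  -- `∫ (u_θ - u_θ') ∂b` turns `T_θ` into the residual kernel, and the contraction estimate applies.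
  have hulip : ∀ θ θ' z, ‖u θ z - u θ' z‖ ≤ solLipConst ε κ N * ‖θ - θ'‖ := fun θ θ' z => by
    have key := norm_le_of_eq_add_residual (hb := hb θ) (w := fun z => u θ z - u θ' z)
      (g := fun z => S.H N θ z - S.H N θ' z +
        (∫ z', u θ' z' ∂S.T N θ z - ∫ z', u θ' z' ∂S.T N θ' z))
      (C := solConst ε κ N + solConst ε κ N)
      (c := (gradConst ε κ N + kernelConst ε κ N * solConst ε κ N) * ‖θ - θ'‖) h0
      (fun z => (norm_sub_le _ _).trans (add_le_add (hub θ z) (hub θ' z)))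
      (fun z => by
        rw [add_mul]
        exact (norm_add_le _ _).trans (add_le_add ((hH z).lip θ θ') (hTlip θ θ' z)))
      (fun z => by
        have hi : ∀ μ : Measure (State X Y E N), IsFiniteMeasure μ →
            Integrable (fun z => u θ z - u θ' z) μ := fun μ _ =>
          (integrable_of_bound (hum θ) (hub θ)).sub (integrable_of_bound (hum θ') (hub θ'))
        have h1 : ∫ z', (u θ z' - u θ' z') ∂S.T N θ z =
            ∫ z', (u θ z' - u θ' z') ∂residual (S.kernelT N θ) b (hb θ) z +
            ∫ z', (u θ z' - u θ' z') ∂b := by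
          rw [← kernelT_apply, ← residual_add (S.kernelT N θ) b (hb θ) z,
            integral_add_measure (hi _ inferInstance) (hi _ inferInstance)]
        have h2 : ∫ z', (u θ z' - u θ' z') ∂b = ∫ z', u θ z' ∂b - ∫ z', u θ' z' ∂b :=
          integral_sub (integrable_of_bound (hum θ) (hub θ))
            (integrable_of_bound (hum θ') (hub θ'))
        have h3 := hsub θ θ' z
        rw [h1, h2] at h3
        calc u θ z - u θ' z = S.H N θ z - S.H N θ' z +
              (∫ z', u θ z' ∂S.T N θ z - ∫ z', u θ' z' ∂S.T N θ' z) -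
              (∫ z', u θ z' ∂b - ∫ z', u θ' z' ∂b) := by
              rw [hueq θ z, hueq θ' z]
              abel
          _ = _ := by
              rw [h3]
              abel) z
    refine key.trans ?_
    rw [solLipConst, div_mul_eq_mul_div]
    exact div_le_div_of_nonneg_left (by positivity) hδ hδle
  refine ⟨by unfold poissonConst; linarith, u, fun θ => (hum θ).measurable, fun θ z => ?_,
    fun θ z => ⟨?_, ?_, ?_⟩, fun θ θ' z => ⟨?_, ?_, ?_⟩⟩
  · rw [hmf θ]
    nth_rw 1 [hueq θ z]
    abel
  · exact ((hH z).bound θ).trans (by unfold poissonConst; linarith)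
  · exact (hub θ z).trans (by unfold poissonConst; linarith)
  · exact (hTb θ z (hub θ)).trans (by unfold poissonConst; linarith)
  · exact ((hH z).lip θ θ').trans (by
      gcongr
      unfold poissonConst
      linarith)
  · rw [hsub]
    refine (norm_add_le_of_le (hTb θ z (hulip θ θ')) (hTlip θ θ' z)).trans ?_
    rw [← add_mul]
    gcongr
    unfold poissonConst
    linarith
  · rw [hmf θ, hmf θ', ← integral_sub (integrable_of_bound (hum θ) (hub θ))
      (integrable_of_bound (hum θ') (hub θ'))]
    refine (norm_integral_le_mul (hulip θ θ')).trans ?_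
    calc _ ≤ solLipConst ε κ N * ‖θ - θ'‖ * 1 := by gcongr
      _ ≤ _ := by
        rw [mul_one]
        gcongr
        unfold poissonConst
        linarith

end StrongMixing

end Model

/-! ### Joint measurability and the Markov property of the chain -/

namespace Model

variable {X Y E : Type*} [MeasurableSpace X] [MeasurableSpace Y] [MeasurableSpace E] {d : ℕ}
  {S : Model X Y E d} {N : ℕ} {ε κ : ℝ}

lemma continuous_of_norm_sub_le {F G : Type*} [SeminormedAddCommGroup F]
    [SeminormedAddCommGroup G] {f : F → G} {C : ℝ} (h : ∀ x y, ‖f x - f y‖ ≤ C * ‖x - y‖) :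
    Continuous f :=
  (LipschitzWith.of_dist_le_mul (K := C.toNNReal) fun x y => by
    rw [dist_eq_norm, dist_eq_norm]
    exact (h x y).trans (by gcongr; exact Real.le_coe_toNNReal C)).continuous

lemma measurable_iter {Ω : Type*} [MeasurableSpace Ω]
    (hH : Measurable fun w : EuclideanSpace ℝ (Fin d) × State X Y E N => S.H N w.1 w.2)
    (γ : ℕ → ℝ) (θ₀ : EuclideanSpace ℝ (Fin d)) {Z : ℕ → Ω → State X Y E N} (t : ℕ)
    (hZ : ∀ s ≤ t, Measurable (Z s)) : Measurable fun ω => S.iter N γ θ₀ (fun s => Z s ω) t := by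
  induction t with
  | zero => exact measurable_const
  | succ t ih =>
    have h := ih fun s hs => hZ s (hs.trans t.le_succ)
    exact h.add ((hH.comp (h.prodMk (hZ (t + 1) le_rfl))).const_smul (γ (t + 1)))

/-- The σ-algebra generated by the trajectory up to time `t`. -/
abbrev history {Ω : Type*} (Z : ℕ → Ω → State X Y E N) (t : ℕ) : MeasurableSpace Ω :=
  ⨆ (s : ℕ) (_ : s ≤ t), MeasurableSpace.comap (Z s) inferInstance

lemma history_le {Ω : Type*} [mΩ : MeasurableSpace Ω] {Z : ℕ → Ω → State X Y E N}
    (hZ : ∀ s, Measurable (Z s)) (t : ℕ) : history Z t ≤ mΩ :=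
  iSup₂_le fun s _ => (hZ s).comap_le

lemma measurable_history {Ω : Type*} (Z : ℕ → Ω → State X Y E N) {s t : ℕ} (hst : s ≤ t) :
    Measurable[history Z t] (Z s) :=
  (comap_measurable (Z s)).mono
    (le_iSup₂ (f := fun (s : ℕ) (_ : s ≤ t) => MeasurableSpace.comap (Z s) inferInstance) s hst)
    le_rfl

namespace StrongMixing

variable (hs : S.StrongMixing ε) (hl : S.LipschitzGradients κ) (hε₀ : 0 < ε) (hκ : 0 ≤ κ)
  (hN : 0 < N)

include hs hl hε₀ hκ hN

/-- Carathéodory's criterion: continuity in `θ` for fixed `z` and measurability in `z` for fixed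
`θ`. The iterates are random, so joint measurability is needed. -/
lemma measurable_H_uncurry :
    Measurable fun w : EuclideanSpace ℝ (Fin d) × State X Y E N => S.H N w.1 w.2 :=
  measurable_uncurry_of_continuous_of_measurable (u := fun θ z => S.H N θ z)
    (fun z => continuous_of_norm_sub_le (hs.boundedLip_H hl hε₀ hκ hN z).lip)
    fun θ => hs.measurable_H hl hε₀ hκ hN θ

lemma measurable_T_uncurry :
    Measurable fun w : EuclideanSpace ℝ (Fin d) × State X Y E N => S.T N w.1 w.2 := by
  have hmark := hs.isMarkovKernel hε₀ hN
  refine Measure.measurable_of_measurable_coe _ fun A hA => ?_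
  have hf : StronglyMeasurable (A.indicator (1 : State X Y E N → ℝ)) :=
    stronglyMeasurable_one.indicator hA
  have hC : ∀ z, ‖A.indicator (1 : State X Y E N → ℝ) z‖ ≤ 1 := fun z => by
    by_cases h : z ∈ A <;> simp [h]
  have h1 : ∀ w : EuclideanSpace ℝ (Fin d) × State X Y E N, S.T N w.1 w.2 A =
      ENNReal.ofReal (∫ z', A.indicator (1 : State X Y E N → ℝ) z' ∂S.T N w.1 w.2) := fun w => by
    rw [integral_indicator_one hA, ← kernelT_apply, ofReal_measureReal]
  simp_rw [h1]
  refine (measurable_uncurry_of_continuous_of_measurable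
    (u := fun θ z => ∫ z', A.indicator (1 : State X Y E N → ℝ) z' ∂S.T N θ z)
    (fun z => continuous_of_norm_sub_le (fun θ θ' =>
      hs.norm_integral_T_sub_le hl hε₀ hκ hN θ θ' z hf hC)) fun θ => ?_).ennreal_ofReal
  exact (hf.integral_kernel (κ := S.kernelT N θ)).measurable

variable {Ω : Type*} [MeasurableSpace Ω] {P : Measure Ω} [IsProbabilityMeasure P] {γ : ℕ → ℝ}
  {θ₀ : EuclideanSpace ℝ (Fin d)} {Z : ℕ → Ω → State X Y E N}

/-- The law of the next state given the current parameter and state. -/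
lemma map_iter_eq_compProd (hZ : S.IsChain N γ θ₀ P Z) (t : ℕ)
    (K : Kernel (EuclideanSpace ℝ (Fin d) × State X Y E N) (State X Y E N)) [IsMarkovKernel K]
    (hK : ∀ θ z, K (θ, z) = S.T N θ z) :
    P.map (fun ω => ((S.iter N γ θ₀ (fun s => Z s ω) t, Z t ω), Z (t + 1) ω)) =
      P.map (fun ω => (S.iter N γ θ₀ (fun s => Z s ω) t, Z t ω)) ⊗ₘ K := by
  have hHm := hs.measurable_H_uncurry hl hε₀ hκ hN
  set W : Ω → EuclideanSpace ℝ (Fin d) × State X Y E N :=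
    fun ω => (S.iter N γ θ₀ (fun s => Z s ω) t, Z t ω) with hWdef
  have hle := history_le hZ.measurable t
  have hWt : Measurable[history Z t] W :=
    (@measurable_iter _ _ _ _ _ _ d S N Ω (history Z t) hHm γ θ₀ Z t
      fun _ => measurable_history Z).prodMk (measurable_history Z le_rfl)
  have hW : Measurable W := hWt.mono hle le_rfl
  have hZt := hZ.measurable (t + 1)
  have : IsProbabilityMeasure (P.map W) := Measure.isProbabilityMeasure_map hW.aemeasurable
  have : IsProbabilityMeasure (P.map fun ω => (W ω, Z (t + 1) ω)) :=
    Measure.isProbabilityMeasure_map (hW.prodMk hZt).aemeasurable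
  -- The transition property concerns functions of `Z (t + 1)` alone. Rectangles `B ×ˢ A` suffice:
  -- the event `W ∈ B` belongs to the history, and the conditional expectation of the indicator of
  -- `A` is integrated over it.
  refine Measure.ext_prod fun {B A} hB hA => ?_
  rw [Measure.compProd_apply_prod hB hA, Measure.map_apply (hW.prodMk hZt) (hB.prod hA),
    setLIntegral_map hB (K.measurable_coe hA) hW]
  have hpre : (fun ω => (W ω, Z (t + 1) ω)) ⁻¹' (B ×ˢ A) = W ⁻¹' B ∩ Z (t + 1) ⁻¹' A := rfl
  have hfin : ∫⁻ ω in W ⁻¹' B, K (W ω) A ∂P ≠ ⊤ :=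
    ((lintegral_mono fun ω => prob_le_one).trans_lt (by simp)).ne
  rw [hpre, ← ENNReal.toReal_eq_toReal_iff' (measure_ne_top _ _) hfin,
    ← integral_toReal (f := fun ω => K (W ω) A) ((K.measurable_coe hA).comp hW).aemeasurable
      (ae_of_all _ fun ω => measure_lt_top _ _)]
  have hcond : P[fun ω => A.indicator (1 : State X Y E N → ℝ) (Z (t + 1) ω) | history Z t] =ᵐ[P]
      fun ω => ∫ z', A.indicator (1 : State X Y E N → ℝ) z'
        ∂S.T N (S.iter N γ θ₀ (fun s => Z s ω) t) (Z t ω) :=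
    hZ.trans t (A.indicator 1) (measurable_one.indicator hA) ⟨1, fun z => by by_cases h : z ∈ A <;> simp [h]⟩
  have hi : Integrable (fun ω => A.indicator (1 : State X Y E N → ℝ) (Z (t + 1) ω)) P :=
    integrable_of_bound (C := 1)
      ((measurable_one.indicator hA).comp hZt).stronglyMeasurable
      fun ω => by by_cases h : Z (t + 1) ω ∈ A <;> simp [h]
  have h1 := setIntegral_condExp hle hi (hWt hB)
  rw [setIntegral_congr_ae (hle _ (hWt hB)) (hcond.mono fun ω h _ => h)] at h1
  have h2 : ∀ ω, ∫ z', A.indicator (1 : State X Y E N → ℝ) z'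
      ∂S.T N (S.iter N γ θ₀ (fun s => Z s ω) t) (Z t ω) = (K (W ω) A).toReal := fun ω => by
    rw [integral_indicator_one hA, hWdef, hK]
    rfl
  simp_rw [h2] at h1
  rw [h1]
  have h3 : (fun ω => A.indicator (1 : State X Y E N → ℝ) (Z (t + 1) ω)) =
      (Z (t + 1) ⁻¹' A).indicator 1 := rfl
  rw [h3, integral_indicator_one (hZt hA), measureReal_restrict_apply (hZt hA), Set.inter_comm]
  rfl

/-- Integrals against the law of the next state. -/
lemma integral_chain (hZ : S.IsChain N γ θ₀ P Z) (t : ℕ)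
    {f : EuclideanSpace ℝ (Fin d) → State X Y E N → State X Y E N → ℝ} {C : ℝ}
    (hf : Measurable fun p : (EuclideanSpace ℝ (Fin d) × State X Y E N) × State X Y E N =>
      f p.1.1 p.1.2 p.2) (hC : ∀ θ z z', |f θ z z'| ≤ C) :
    ∫ ω, f (S.iter N γ θ₀ (fun s => Z s ω) t) (Z t ω) (Z (t + 1) ω) ∂P =
      ∫ ω, ∫ z', f (S.iter N γ θ₀ (fun s => Z s ω) t) (Z t ω) z'
        ∂S.T N (S.iter N γ θ₀ (fun s => Z s ω) t) (Z t ω) ∂P := by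
  have hHm := hs.measurable_H_uncurry hl hε₀ hκ hN
  let K : Kernel (EuclideanSpace ℝ (Fin d) × State X Y E N) (State X Y E N) :=
    ⟨fun w => S.T N w.1 w.2, hs.measurable_T_uncurry hl hε₀ hκ hN⟩
  have hKm : IsMarkovKernel K := ⟨fun w => ⟨hs.T_univ hε₀ hN w.1 w.2⟩⟩
  have hW : Measurable fun ω => (S.iter N γ θ₀ (fun s => Z s ω) t, Z t ω) :=
    (measurable_iter hHm γ θ₀ t fun s _ => hZ.measurable s).prodMk (hZ.measurable t)
  have hWZ := hW.prodMk (hZ.measurable (t + 1))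
  have := Measure.isProbabilityMeasure_map (μ := P) hW.aemeasurable
  have hmap := hs.map_iter_eq_compProd hl hε₀ hκ hN hZ t K fun _ _ => rfl
  have h1 := integral_map (μ := P) hWZ.aemeasurable hf.aestronglyMeasurable
  rw [hmap, Measure.integral_compProd (integrable_of_bound hf.stronglyMeasurable
    fun p => hC _ _ _), integral_map hW.aemeasurable] at h1
  · exact h1.symm
  · exact (hf.stronglyMeasurable.integral_kernel_prod_right' (κ := K)).aestronglyMeasurable

end StrongMixing

end Model

/-! ### Two deterministic inequalities -/

/-- Quadratic lower bound for a function with Lipschitz gradient. -/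
lemma add_inner_sub_le_of_lipschitz_gradient {F : Type*} [NormedAddCommGroup F]
    [InnerProductSpace ℝ F] [CompleteSpace F] {V : F → ℝ} {h : F → F} {α : ℝ} (hα : 0 ≤ α)
    (hV : ∀ θ, HasGradientAt V (h θ) θ) (hh : ∀ θ θ', ‖h θ - h θ'‖ ≤ α * ‖θ - θ'‖) (θ v : F) :
    V θ + inner ℝ (h θ) v - α * ‖v‖ ^ 2 ≤ V (θ + v) := by
  -- The mean value inequality uses the bound `α * ‖v‖` on the variation of the gradient over the
  -- whole segment, hence `α` where integration would give `α / 2`.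
  have key := (convex_segment θ (θ + v)).norm_image_sub_le_of_norm_hasFDerivWithin_le'
    (f := V) (f' := fun x => InnerProductSpace.toDual ℝ F (h x))
    (φ := InnerProductSpace.toDual ℝ F (h θ)) (C := α * ‖v‖)
    (fun x _ => (hV x).hasFDerivAt.hasFDerivWithinAt)
    (fun x hx => by
      rw [← map_sub, LinearIsometryEquiv.norm_map]
      refine (hh x θ).trans ?_
      gcongr
      have := norm_sub_le_of_mem_segment hx
      simpa using this)
    (left_mem_segment ℝ _ _) (right_mem_segment ℝ _ _)
  rw [add_sub_cancel_left, InnerProductSpace.toDual_apply_apply, Real.norm_eq_abs] at key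
  have := (abs_le.1 key).1
  nlinarith

/-- Summation by parts of the Poisson remainder along a trajectory. -/
lemma sum_poisson_remainder_le {γ p r : ℕ → ℝ} {α : ℝ} (hα : 0 ≤ α)
    (hpos : ∀ t, 1 ≤ t → 0 < γ t) (hanti : ∀ t, 1 ≤ t → γ (t + 1) ≤ γ t)
    (hp : ∀ t, |p t| ≤ α ^ 2) (hr : ∀ t, |r t| ≤ α ^ 2)
    (hpr : ∀ t, |r (t + 1) - p t| ≤ 2 * α ^ 3 * γ (t + 1)) (t : ℕ) :
    ∑ s ∈ Finset.range (t + 1), γ (s + 1) * (p s - r s) ≤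
      2 * α ^ 2 * γ 1 + 2 * α ^ 3 * ∑ s ∈ Finset.range (t + 1), γ (s + 1) ^ 2 := by
  -- The boundary term `γ (t + 1) * p t` is kept for the induction: at the next step it is paired
  -- with `γ (t + 2) * r (t + 1)`, which costs a step-size decrement times `α ^ 2` and a drift of
  -- order `γ ^ 2`.
  have h : ∀ t, ∑ s ∈ Finset.range (t + 1), γ (s + 1) * (p s - r s) ≤
      γ (t + 1) * p t + α ^ 2 * γ 1 + α ^ 2 * (γ 1 - γ (t + 1)) +
        2 * α ^ 3 * ∑ s ∈ Finset.range t, γ (s + 1) ^ 2 := by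
    intro t
    induction t with
    | zero =>
      have h1 := hpos 1 le_rfl
      have h2 := (abs_le.1 (hr 0)).1
      simp only [zero_add, Finset.sum_range_one, Finset.range_zero, Finset.sum_empty]
      nlinarith
    | succ t ih =>
      rw [Finset.sum_range_succ _ (t + 1), Finset.sum_range_succ (fun s => γ (s + 1) ^ 2) t]
      have h1 := hpos (t + 1) (by omega)
      have h2 := hpos (t + 1 + 1) (by omega)
      have h3 := hanti (t + 1) (by omega)
      have h4 := (abs_le.1 (hpr t)).1
      have h5 := (abs_le.1 (hp t)).2
      have h6 : (γ (t + 1) - γ (t + 1 + 1)) * p t ≤ (γ (t + 1) - γ (t + 1 + 1)) * α ^ 2 :=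
        mul_le_mul_of_nonneg_left h5 (by linarith)
      have h7 : γ (t + 1 + 1) * (p t - r (t + 1)) ≤
          γ (t + 1 + 1) * (2 * α ^ 3 * γ (t + 1)) :=
        mul_le_mul_of_nonneg_left (by linarith) h2.le
      have h8 : γ (t + 1 + 1) * (2 * α ^ 3 * γ (t + 1)) ≤
          γ (t + 1) * (2 * α ^ 3 * γ (t + 1)) :=
        mul_le_mul_of_nonneg_right h3 (by positivity)
      linarith
  refine (h t).trans ?_
  have h1 := hpos (t + 1) (by omega)
  -- Bounding the boundary term cancels the `- α ^ 2 * γ (t + 1)` left by the telescoped decrements,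
  -- which leaves `2 * α ^ 2 * γ 1`.
  have h2 : γ (t + 1) * p t ≤ γ (t + 1) * α ^ 2 :=
    mul_le_mul_of_nonneg_left (abs_le.1 (hp t)).2 h1.le
  rw [Finset.sum_range_succ _ t]
  have : 0 ≤ 2 * α ^ 3 * γ (t + 1) ^ 2 := by positivity
  linarith

/-! ### The mean field along the iterates -/

namespace Model

variable {X Y E : Type*} [MeasurableSpace X] [MeasurableSpace Y] [MeasurableSpace E] {d : ℕ}
  {S : Model X Y E d} {N : ℕ} {ε κ : ℝ}

namespace StrongMixing

variable (hs : S.StrongMixing ε) (hl : S.LipschitzGradients κ) (hε₀ : 0 < ε) (hκ : 0 ≤ κ)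
  (hN : 0 < N)

include hs hε₀ hN

lemma norm_meanField_le {α : ℝ} (hα : S.IsPoissonConstant N α) (θ : EuclideanSpace ℝ (Fin d)) :
    ‖S.meanField N θ‖ ≤ α := by
  obtain ⟨_, _, _, hb, _⟩ := hα.exists_sol
  have := (hs.isStationary_stat hε₀ hN θ).prob
  exact (norm_integral_le_mul fun z => (hb θ z).1).trans_eq (by simp)

include hl hκ

variable {Ω : Type*} [MeasurableSpace Ω] {P : Measure Ω} [IsProbabilityMeasure P] {γ : ℕ → ℝ}
  {θ₀ : EuclideanSpace ℝ (Fin d)} {Z : ℕ → Ω → State X Y E N}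

lemma continuous_meanField : Continuous (S.meanField N) := by
  obtain ⟨_, _, _, _, hlip⟩ := (hs.isPoissonConstant hε₀ hN hl hκ).exists_sol
  obtain ⟨z⟩ := S.nonempty_state N
  exact continuous_of_norm_sub_le fun θ θ' => (hlip θ θ' z).2.2

/-- The averaged squared mean field along the iterates. -/
lemma sum_integral_sq_norm_le {α B : ℝ} (hα : S.IsPoissonConstant N α)
    {V : EuclideanSpace ℝ (Fin d) → ℝ} (hB : ∀ θ, |V θ| ≤ B)
    (hV : ∀ θ, HasGradientAt V (S.meanField N θ) θ)
    (hpos : ∀ t, 1 ≤ t → 0 < γ t) (hanti : ∀ t, 1 ≤ t → γ (t + 1) ≤ γ t)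
    (hZ : S.IsChain N γ θ₀ P Z) (t : ℕ) :
    Integrable (fun ω => V (S.iter N γ θ₀ (fun s => Z s ω) (t + 1)) - V θ₀) P ∧
    ∑ s ∈ Finset.range (t + 1), γ (s + 1) *
        ∫ ω, ‖S.meanField N (S.iter N γ θ₀ (fun s => Z s ω) s)‖ ^ 2 ∂P ≤
      ∫ ω, (V (S.iter N γ θ₀ (fun s => Z s ω) (t + 1)) - V θ₀) ∂P + 2 * α ^ 2 * γ 1 +
        3 * α ^ 3 * ∑ s ∈ Finset.range (t + 1), γ (s + 1) ^ 2 := by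
  have hα0 : 0 ≤ α := zero_le_one.trans hα.one_le
  have hh := hs.norm_meanField_le hε₀ hN hα
  have hhc := hs.continuous_meanField hl hε₀ hκ hN
  have hHm := hs.measurable_H_uncurry hl hε₀ hκ hN
  have hmark := hs.isMarkovKernel hε₀ hN
  obtain ⟨z₀⟩ := S.nonempty_state N
  obtain ⟨G, hGm, hGeq, hGb, hGl⟩ := hα.exists_sol
  set A : EuclideanSpace ℝ (Fin d) → State X Y E N → EuclideanSpace ℝ (Fin d) :=
    fun θ z => ∫ z', G θ z' ∂S.T N θ z with hA
  have hAm : Measurable fun w : EuclideanSpace ℝ (Fin d) × State X Y E N => A w.1 w.2 :=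
    measurable_uncurry_of_continuous_of_measurable (u := A)
      (fun z => continuous_of_norm_sub_le fun θ θ' => (hGl θ θ' z).2.1)
      fun θ => ((hGm θ).stronglyMeasurable.integral_kernel (κ := S.kernelT N θ)).measurable
  have hGA : ∀ θ z, G θ z = S.H N θ z - S.meanField N θ + A θ z := fun θ z => by
    rw [hGeq θ z]
    abel
  -- No regularity of `G` in `θ` is given; its joint measurability is read off from the Poisson
  -- equation, whose other terms are continuous in `θ`.
  have hGm' : Measurable fun w : EuclideanSpace ℝ (Fin d) × State X Y E N => G w.1 w.2 := by
    simp_rw [hGA]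
    exact (hHm.sub (hhc.measurable.comp measurable_fst)).add hAm
  let θ : ℕ → Ω → EuclideanSpace ℝ (Fin d) := fun s ω => S.iter N γ θ₀ (fun s => Z s ω) s
  have hθm : ∀ s, Measurable (θ s) := fun s =>
    measurable_iter hHm γ θ₀ s fun s _ => hZ.measurable s
  have hVm : Measurable V := (continuous_iff_continuousAt.2 fun θ =>
    (hV θ).hasFDerivAt.continuousAt).measurable
  have hVi : Integrable (fun ω => V (θ (t + 1) ω) - V θ₀) P :=
    integrable_of_bound (C := B + B)
      ((hVm.comp (hθm _)).sub_const _).stronglyMeasurable fun ω =>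
      (norm_sub_le _ _).trans (add_le_add (hB _) (hB _))
  refine ⟨hVi, ?_⟩
  have hinner : ∀ u v : EuclideanSpace ℝ (Fin d), ‖u‖ ≤ α → ‖v‖ ≤ α → |inner ℝ u v| ≤ α ^ 2 :=
    fun u v hu hv => (abs_real_inner_le_norm u v).trans (by rw [pow_two]; gcongr)
  -- The martingale increment: `G` is evaluated at the new state and `A = T G` at the old one, both
  -- at the current parameter, so the conditional mean vanishes.
  let M : ℕ → Ω → ℝ := fun s ω => inner ℝ (S.meanField N (θ s ω)) (G (θ s ω) (Z (s + 1) ω)) -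
    inner ℝ (S.meanField N (θ s ω)) (A (θ s ω) (Z s ω))
  have hM1i : ∀ s, Integrable (fun ω =>
      inner ℝ (S.meanField N (θ s ω)) (G (θ s ω) (Z (s + 1) ω))) P := fun s =>
    integrable_of_bound (C := α ^ 2) ((hhc.measurable.comp (hθm s)).inner
      (hGm'.comp ((hθm s).prodMk (hZ.measurable _)))).stronglyMeasurable
      fun ω => hinner _ _ (hh _) (hGb _ _).2.1
  have hM2i : ∀ s, Integrable (fun ω =>
      inner ℝ (S.meanField N (θ s ω)) (A (θ s ω) (Z s ω))) P := fun s =>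
    integrable_of_bound (C := α ^ 2) ((hhc.measurable.comp (hθm s)).inner
      (hAm.comp ((hθm s).prodMk (hZ.measurable _)))).stronglyMeasurable
      fun ω => hinner _ _ (hh _) (hGb _ _).2.2
  have hMi : ∀ s, Integrable (M s) P := fun s => (hM1i s).sub (hM2i s)
  have hM0 : ∀ s, ∫ ω, M s ω ∂P = 0 := fun s => by
    rw [integral_sub (hM1i s) (hM2i s), hs.integral_chain hl hε₀ hκ hN hZ s
      (f := fun θ _ z' => inner ℝ (S.meanField N θ) (G θ z')) (C := α ^ 2)
      ((hhc.measurable.comp (measurable_fst.comp measurable_fst)).inner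
        (hGm'.comp ((measurable_fst.comp measurable_fst).prodMk measurable_snd)))
      (fun θ _ z' => hinner _ _ (hh _) (hGb _ _).2.1), sub_eq_zero]
    refine integral_congr_ae (ae_of_all _ fun ω => ?_)
    exact integral_inner (integrable_of_bound (μ := S.kernelT N (θ s ω) (Z s ω))
      (hGm _).stronglyMeasurable fun z => (hGb _ z).2.1) _
  have hpath : ∀ ω, ∑ s ∈ Finset.range (t + 1), γ (s + 1) * ‖S.meanField N (θ s ω)‖ ^ 2 +
      ∑ s ∈ Finset.range (t + 1), γ (s + 1) * M s ω ≤
      (V (θ (t + 1) ω) - V θ₀) + (2 * α ^ 2 * γ 1 +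
        3 * α ^ 3 * ∑ s ∈ Finset.range (t + 1), γ (s + 1) ^ 2) := fun ω => by
    let p : ℕ → ℝ := fun s => inner ℝ (S.meanField N (θ s ω)) (A (θ s ω) (Z (s + 1) ω))
    let r : ℕ → ℝ := fun s => inner ℝ (S.meanField N (θ s ω)) (A (θ s ω) (Z s ω))
    have hstep : ∀ s, θ (s + 1) ω = θ s ω + γ (s + 1) • S.H N (θ s ω) (Z (s + 1) ω) :=
      fun s => rfl
    have hstepn : ∀ s, ‖γ (s + 1) • S.H N (θ s ω) (Z (s + 1) ω)‖ ≤ γ (s + 1) * α := fun s => by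
      have h1 := hpos (s + 1) (by omega)
      rw [norm_smul, Real.norm_of_nonneg h1.le]
      gcongr
      exact (hGb _ _).1
    have hrem := sum_poisson_remainder_le (p := p) (r := r) hα0 hpos hanti
      (fun s => hinner _ _ (hh _) (hGb _ _).2.2) (fun s => hinner _ _ (hh _) (hGb _ _).2.2)
      (fun s => by
        have h0 := hpos (s + 1) (by omega)
        -- Both terms have the same state `Z (s + 1)`, and only the parameter moves, by at most `γ
        -- (s + 1) * α`. Each of the two inner products is therefore at most `α ^ 3 * γ (s + 1)`.
        have h1 : r (s + 1) - p s =
            inner ℝ (S.meanField N (θ (s + 1) ω) - S.meanField N (θ s ω))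
              (A (θ (s + 1) ω) (Z (s + 1) ω)) +
            inner ℝ (S.meanField N (θ s ω))
              (A (θ (s + 1) ω) (Z (s + 1) ω) - A (θ s ω) (Z (s + 1) ω)) := by
          rw [inner_sub_left, inner_sub_right]
          ring
        have h2 : ‖θ (s + 1) ω - θ s ω‖ ≤ γ (s + 1) * α := by
          rw [hstep, add_sub_cancel_left]
          exact hstepn s
        have h3 := (hGl (θ (s + 1) ω) (θ s ω) (Z (s + 1) ω)).2
        rw [h1]
        refine (abs_add_le _ _).trans ?_
        calc _ ≤ α * (γ (s + 1) * α) * α + α * (α * (γ (s + 1) * α)) := by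
              refine add_le_add ((abs_real_inner_le_norm _ _).trans ?_)
                ((abs_real_inner_le_norm _ _).trans ?_)
              · refine mul_le_mul (h3.2.trans (by gcongr)) (hGb _ _).2.2 (norm_nonneg _)
                  (by positivity)
              · exact mul_le_mul (hh _) (h3.1.trans (by gcongr)) (norm_nonneg _) hα0
          _ = _ := by ring) t
    -- One ascent step. The term `α ^ 3 * γ (s + 1) ^ 2` is the Taylor error; with the `2 * α ^ 3`
    -- from the Poisson remainder it makes up the final `3 * α ^ 3`.
    have hone : ∀ s, γ (s + 1) * ‖S.meanField N (θ s ω)‖ ^ 2 + γ (s + 1) * M s ω ≤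
        (V (θ (s + 1) ω) - V (θ s ω)) + γ (s + 1) * (p s - r s) +
          α ^ 3 * γ (s + 1) ^ 2 := fun s => by
      have h0 := hpos (s + 1) (by omega)
      have h1 := add_inner_sub_le_of_lipschitz_gradient hα0 hV (fun θ θ' => (hGl θ θ' z₀).2.2)
        (θ s ω) (γ (s + 1) • S.H N (θ s ω) (Z (s + 1) ω))
      rw [← hstep, real_inner_smul_right] at h1
      have h2 : α * ‖γ (s + 1) • S.H N (θ s ω) (Z (s + 1) ω)‖ ^ 2 ≤ α * (γ (s + 1) * α) ^ 2 := by
        have := hstepn s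
        gcongr
      have h3 : inner ℝ (S.meanField N (θ s ω)) (S.H N (θ s ω) (Z (s + 1) ω)) =
          ‖S.meanField N (θ s ω)‖ ^ 2 + M s ω - (p s - r s) := by
        have h4 : S.H N (θ s ω) (Z (s + 1) ω) = S.meanField N (θ s ω) +
            G (θ s ω) (Z (s + 1) ω) - A (θ s ω) (Z (s + 1) ω) := by
          rw [hGA]
          abel
        rw [h4, inner_sub_right, inner_add_right, real_inner_self_eq_norm_sq]
        simp only [M, p, r]
        ring
      rw [h3] at h1
      nlinarith
    have hsum := Finset.sum_le_sum fun s (_ : s ∈ Finset.range (t + 1)) => hone s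
    rw [Finset.sum_add_distrib, Finset.sum_add_distrib, Finset.sum_add_distrib,
      Finset.sum_range_sub (fun s => V (θ s ω)), ← Finset.mul_sum] at hsum
    have h00 : θ 0 ω = θ₀ := rfl
    rw [h00] at hsum
    linarith
  have hsqi : ∀ s, Integrable (fun ω => ‖S.meanField N (θ s ω)‖ ^ 2) P := fun s =>
    integrable_of_bound (C := α ^ 2) ((hhc.measurable.comp (hθm s)).norm.pow_const
      2).stronglyMeasurable fun ω => by
        rw [norm_pow, norm_norm]
        have := hh (θ s ω)
        gcongr
  have hi1 : Integrable (fun ω =>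
      ∑ s ∈ Finset.range (t + 1), γ (s + 1) * ‖S.meanField N (θ s ω)‖ ^ 2) P :=
    integrable_finsetSum _ fun s _ => (hsqi s).const_mul _
  have hi2 : Integrable (fun ω => ∑ s ∈ Finset.range (t + 1), γ (s + 1) * M s ω) P :=
    integrable_finsetSum _ fun s _ => (hMi s).const_mul _
  have hint := integral_mono (hi1.add hi2) (hVi.add (integrable_const _)) hpath
  simp only [Pi.add_apply] at hint
  rw [integral_add hi1 hi2, integral_add hVi (integrable_const _),
    integral_finsetSum _ fun s _ => (hsqi s).const_mul _,
    integral_finsetSum _ fun s _ => (hMi s).const_mul _] at hint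
  simp_rw [integral_const_mul, hM0] at hint
  simp only [mul_zero, Finset.sum_const_zero, add_zero, integral_const, probReal_univ,
    one_smul] at hint
  linarith

/-- The squared mean field at a random iterate. -/
lemma integral_sq_norm_categorical {α : ℝ} (hα : S.IsPoissonConstant N α)
    (hpos : ∀ t, 1 ≤ t → 0 < γ t) (hZ : S.IsChain N γ θ₀ P Z) (t : ℕ) {τ : Ω → Fin (t + 1)}
    (hτ : IsCategorical P γ t τ) (hind : IndepFun τ (fun ω s => Z s ω) P) :
    Integrable (fun ω => ‖S.meanField N (S.iter N γ θ₀ (fun s => Z s ω) (τ ω))‖ ^ 2) P ∧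
    ∫ ω, ‖S.meanField N (S.iter N γ θ₀ (fun s => Z s ω) (τ ω))‖ ^ 2 ∂P =
      (∑ s ∈ Finset.range (t + 1), γ (s + 1) *
        ∫ ω, ‖S.meanField N (S.iter N γ θ₀ (fun s => Z s ω) s)‖ ^ 2 ∂P) /
        ∑ s ∈ Finset.range (t + 1), γ (s + 1) := by
  have hh := hs.norm_meanField_le hε₀ hN hα
  have hhc := hs.continuous_meanField hl hε₀ hκ hN
  have hHm := hs.measurable_H_uncurry hl hε₀ hκ hN
  let g : ℕ → (ℕ → State X Y E N) → ℝ := fun s z => ‖S.meanField N (S.iter N γ θ₀ z s)‖ ^ 2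
  have hg : ∀ s, Measurable (g s) := fun s =>
    ((hhc.measurable.comp (measurable_iter (Ω := ℕ → State X Y E N) (Z := fun s z => z s) hHm γ θ₀ s
      fun s _ => measurable_pi_apply s)).norm).pow_const 2
  have hZm : Measurable fun ω s => Z s ω := measurable_pi_lambda _ hZ.measurable
  have hgi : ∀ s, Integrable (fun ω => g s fun s => Z s ω) P := fun s =>
    integrable_of_bound (C := α ^ 2) ((hg s).comp hZm).stronglyMeasurable fun ω => by
        rw [norm_pow, norm_norm]
        have := hh (S.iter N γ θ₀ (fun s => Z s ω) s)
        gcongr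
  let e : Fin (t + 1) → Fin (t + 1) → ℝ := fun s => ({s} : Set (Fin (t + 1))).indicator 1
  have he : ∀ s, Measurable (e s) := fun s => measurable_one.indicator (measurableSet_singleton s)
  have heτ : ∀ s, (fun ω => e s (τ ω)) = {ω | τ ω = s}.indicator 1 := fun s => rfl
  have hτs : ∀ s, MeasurableSet {ω | τ ω = s} := fun s =>
    hτ.measurable (measurableSet_singleton s)
  have hei : ∀ s, Integrable (fun ω => e s (τ ω)) P := fun s => by
    rw [heτ]
    exact (integrable_const (1 : ℝ)).indicator (hτs s)
  -- Decomposition over the value of `τ`; independence from the trajectory then factors each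
  -- expectation.
  have hdec : (fun ω => ‖S.meanField N (S.iter N γ θ₀ (fun s => Z s ω) (τ ω))‖ ^ 2) =
      fun ω => ∑ s : Fin (t + 1), e s (τ ω) * g s fun s => Z s ω := by
    funext ω
    rw [Finset.sum_eq_single (τ ω)]
    · simp [e, g]
    · intro s _ hne
      simp [e, hne.symm]
    · simp
  have hindep : ∀ s : Fin (t + 1),
      IndepFun (fun ω => e s (τ ω)) (fun ω => g s fun s => Z s ω) P := fun s =>
    hind.comp (he s) (hg s)
  have hsum0 : 0 ≤ ∑ r ∈ Finset.range (t + 1), γ (r + 1) :=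
    Finset.sum_nonneg fun r _ => (hpos (r + 1) (by omega)).le
  have hmul : ∀ s : Fin (t + 1), Integrable (fun ω => e s (τ ω) * g s fun s => Z s ω) P :=
    fun s => (hindep s).integrable_mul (hei s) (hgi s)
  rw [hdec]
  refine ⟨integrable_finsetSum _ fun s _ => hmul s, ?_⟩
  rw [integral_finsetSum _ fun s _ => hmul s,
    Finset.sum_div, Finset.sum_range]
  refine Finset.sum_congr rfl fun s _ => ?_
  have hprod := (hindep s).integral_mul_eq_mul_integral (hei s).aestronglyMeasurable
    (hgi s).aestronglyMeasurable
  have hP : ∫ ω, e s (τ ω) ∂P = γ (s + 1) / ∑ r ∈ Finset.range (t + 1), γ (r + 1) := by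
    rw [heτ, integral_indicator_one (hτs s), measureReal_def, hτ.prob,
      ENNReal.toReal_ofReal (div_nonneg (hpos _ (by omega)).le hsum0)]
  simp only [Pi.mul_apply] at hprod
  rw [hprod, hP]
  ring

end StrongMixing

end Model

end OVSMC

/-! ### Assembly of the theorem -/

theorem theorem4p7 {X Y E Ω : Type*} [MeasurableSpace X] [MeasurableSpace Y] [MeasurableSpace E]
    [MeasurableSpace Ω] (P : Measure Ω) [IsProbabilityMeasure P] (d N : ℕ) (hN : 0 < N)
    (ε κ : ℝ) (hε₀ : 0 < ε) (hε₁ : ε < 1) (hκ : 1 ≤ κ) :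
    -- a Poisson constant that is common to all models with mixing constant `ε` and gradient
    -- constant `κ`
    (∃ α : ℝ, ∀ S : OVSMC.Model X Y E d, S.StrongMixing ε → S.LipschitzGradients κ →
      S.IsPoissonConstant N α) ∧
    ∀ S : OVSMC.Model X Y E d, S.StrongMixing ε → S.LipschitzGradients κ →
      -- the mean field is well defined
      (∀ θ, (∃! π, S.IsStationary N θ π) ∧ S.IsStationary N θ (S.stat N θ) ∧
        Integrable (S.H N θ) (S.stat N θ)) ∧
      ∀ V : EuclideanSpace ℝ (Fin d) → ℝ, (∃ B, ∀ θ, |V θ| ≤ B) →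
        (∀ θ, HasGradientAt V (S.meanField N θ) θ) →
        -- the bound with unspecified constants
        (∃ b > 0, ∃ b' > 0, ∀ (γ : ℕ → ℝ) (a a' c : ℝ), OVSMC.StepSizes γ a a' →
          c ∈ Set.Ioo (0 : ℝ) 1 → γ 1 ≤ c →
          ∀ (θ₀ : EuclideanSpace ℝ (Fin d)) (Z : ℕ → Ω → OVSMC.State X Y E N),
            S.IsChain N γ θ₀ P Z → ∀ (t : ℕ) (τ : Ω → Fin (t + 1)),
            OVSMC.IsCategorical P γ t τ → IndepFun τ (fun ω s => Z s ω) P →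
            Integrable (fun ω =>
              ‖S.meanField N (S.iter N γ θ₀ (fun s => Z s ω) (τ ω))‖ ^ 2) P ∧
            ∫ ω, ‖S.meanField N (S.iter N γ θ₀ (fun s => Z s ω) (τ ω))‖ ^ 2 ∂P ≤
              (b + b' * ∑ s ∈ Finset.range (t + 1), γ (s + 1) ^ 2) /
                ∑ s ∈ Finset.range (t + 1), γ (s + 1)) ∧
        -- the bound with explicit constants
        (∀ α : ℝ, S.IsPoissonConstant N α →
          ∀ (γ : ℕ → ℝ) (a a' : ℝ), OVSMC.StepSizes γ a a' →
          γ 1 ≤ 1 / (2 * α + 2 * OVSMC.cH α a a') →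
          ∀ (θ₀ : EuclideanSpace ℝ (Fin d)) (Z : ℕ → Ω → OVSMC.State X Y E N),
            S.IsChain N γ θ₀ P Z → ∀ (t : ℕ) (τ : Ω → Fin (t + 1)),
            OVSMC.IsCategorical P γ t τ → IndepFun τ (fun ω s => Z s ω) P →
            Integrable (fun ω =>
              ‖S.meanField N (S.iter N γ θ₀ (fun s => Z s ω) (τ ω))‖ ^ 2) P ∧
            Integrable (fun ω => V (S.iter N γ θ₀ (fun s => Z s ω) (t + 1)) - V θ₀) P ∧
            ∫ ω, ‖S.meanField N (S.iter N γ θ₀ (fun s => Z s ω) (τ ω))‖ ^ 2 ∂P ≤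
              2 * ((∫ ω, (V (S.iter N γ θ₀ (fun s => Z s ω) (t + 1)) - V θ₀) ∂P) +
                  α * (γ 1 - γ (t + 1) + 2) +
                  (4 * α ^ 3 + α ^ 2 * (2 + α)) * ∑ s ∈ Finset.range (t + 1), γ (s + 1) ^ 2) /
                ∑ s ∈ Finset.range (t + 1), γ (s + 1)) := by
  have hκ0 : 0 ≤ κ := zero_le_one.trans hκ
  refine ⟨⟨OVSMC.poissonConst ε κ N, fun S hs hl => hs.isPoissonConstant hε₀ hN hl hκ0⟩,
    fun S hs hl => ⟨fun θ => ⟨hs.existsUnique_isStationary hε₀ hN θ, hs.isStationary_stat hε₀ hN θ,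
      hs.integrable_H_stat hε₀ hN hl hκ0 θ⟩, fun V hVb hV => ⟨?_, ?_⟩⟩⟩
  · obtain ⟨B, hB⟩ := hVb
    have hα := hs.isPoissonConstant hε₀ hN hl hκ0
    set α := OVSMC.poissonConst ε κ N
    have hα0 : 0 < α := zero_lt_one.trans_le hα.one_le
    have hB0 : 0 ≤ B := (abs_nonneg _).trans (hB 0)
    -- `2 * B` bounds the increment of `V`, and `2 * α ^ 2` bounds `2 * α ^ 2 * γ 1` because `γ 1 ≤
    -- c < 1`.
    refine ⟨2 * B + 2 * α ^ 2, by positivity, 3 * α ^ 3, by positivity,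
      fun γ a a' c hγ hc hγc θ₀ Z hZ t τ hτ hind => ?_⟩
    obtain ⟨hi, heq⟩ := hs.integral_sq_norm_categorical hl hε₀ hκ0 hN hα hγ.pos hZ t hτ hind
    obtain ⟨hVi, hle⟩ := hs.sum_integral_sq_norm_le hl hε₀ hκ0 hN hα hB hV hγ.pos hγ.anti hZ t
    refine ⟨hi, ?_⟩
    rw [heq]
    have hVle : ∫ ω, (V (S.iter N γ θ₀ (fun s => Z s ω) (t + 1)) - V θ₀) ∂P ≤ 2 * B := by
      refine (integral_mono hVi (integrable_const (2 * B)) fun ω => ?_).trans_eq (by simp)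
      have h1 := (abs_le.1 (hB (S.iter N γ θ₀ (fun s => Z s ω) (t + 1)))).2
      have h2 := (abs_le.1 (hB θ₀)).1
      simp only
      linarith
    have hγ1 : 2 * α ^ 2 * γ 1 ≤ 2 * α ^ 2 * 1 := by
      have := hγc.trans hc.2.le
      gcongr
    refine div_le_div_of_nonneg_right (by linarith)
      (Finset.sum_nonneg fun r _ => (hγ.pos (r + 1) (by omega)).le)
  · intro α hα γ a a' hγ hγ1 θ₀ Z hZ t τ hτ hind
    obtain ⟨B, hB⟩ := hVb
    have hα1 := hα.one_le
    have hα0 : 0 < α := zero_lt_one.trans_le hα1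
    obtain ⟨hi, heq⟩ := hs.integral_sq_norm_categorical hl hε₀ hκ0 hN hα hγ.pos hZ t hτ hind
    obtain ⟨hVi, hle⟩ := hs.sum_integral_sq_norm_le hl hε₀ hκ0 hN hα hB hV hγ.pos hγ.anti hZ t
    refine ⟨hi, hVi, ?_⟩
    rw [heq]
    refine div_le_div_of_nonneg_right ?_
      (Finset.sum_nonneg fun r _ => (hγ.pos (r + 1) (by omega)).le)
    have ha := hγ.a_pos
    have ha' := hγ.a'_pos
    have hγpos := hγ.pos 1 le_rfl
    -- The part `α ^ 2` of `α ^ 2 * (2 * a + 1)` suffices: the restriction on `γ 1` then gives `2 *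
    -- α ^ 2 * γ 1 ≤ 1`, which `c_{0,t} ≥ 1` absorbs.
    have hcH : α ^ 2 ≤ OVSMC.cH α a a' := by
      have h1 : 0 ≤ α * (a + 1) / 2 := by positivity
      have h2 : 0 ≤ α ^ 2 * (2 * a) := by positivity
      have h3 : 0 ≤ α * a' := by positivity
      unfold OVSMC.cH
      linarith
    have hD : 0 < 2 * α + 2 * OVSMC.cH α a a' := by
      have : 0 < α ^ 2 := by positivity
      linarith
    have hstep : 2 * α ^ 2 * γ 1 ≤ 1 := by
      rw [le_div_iff₀ hD] at hγ1
      have : γ 1 * (2 * α ^ 2) ≤ γ 1 * (2 * α + 2 * OVSMC.cH α a a') :=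
        mul_le_mul_of_nonneg_left (by linarith) hγpos.le
      linarith
    have hanti : γ (t + 1) ≤ γ 1 := by
      clear hle hVi heq hi hind hτ τ
      induction t with
      | zero => exact le_rfl
      | succ t ih => exact (hγ.anti (t + 1) (by omega)).trans ih
    have hbd : 1 ≤ α * (γ 1 - γ (t + 1) + 2) := by nlinarith
    -- The increment of `V` may be negative, so the factor `2` is not free. The bracket dominates
    -- this nonnegative sum, hence is nonnegative itself and at most twice itself.
    have hX : 0 ≤ ∑ s ∈ Finset.range (t + 1), γ (s + 1) *
        ∫ ω, ‖S.meanField N (S.iter N γ θ₀ (fun s => Z s ω) s)‖ ^ 2 ∂P :=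
      Finset.sum_nonneg fun s _ => mul_nonneg (hγ.pos (s + 1) (by omega)).le
        (integral_nonneg fun ω => by positivity)
    have hsq : 3 * α ^ 3 * ∑ s ∈ Finset.range (t + 1), γ (s + 1) ^ 2 ≤
        (4 * α ^ 3 + α ^ 2 * (2 + α)) * ∑ s ∈ Finset.range (t + 1), γ (s + 1) ^ 2 := by
      refine mul_le_mul_of_nonneg_right ?_ (Finset.sum_nonneg fun s _ => by positivity)
      have : 0 ≤ α ^ 3 := by positivity
      have : 0 ≤ α ^ 2 * (2 + α) := by positivity
      linarith
    linarith
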